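/- For complex numbers $x,q$ write $(x;q)_n=\prod_{i=0}^{n-1}(1-xq^i)$ for $n\ge 0$ (so $(x;q)_0=1$) and, when $|q|<1$, $(x;q)_\infty=\prod_{i=0}^{\infty}(1-xq^i)$; write $(x,y;q)_n=(x;q)_n(y;q)_n$ for $0\le n\le\infty$. Let $a,q\in\mathbb{C}$ with $|q|<1$, $a\neq 0$, and suppose that $aq^k\neq 1$ and $a\neq q^k$ for every integer $k\ge 1$ (so that no denominator below vanishes). Then the three series below converge absolutely, and $$ \sum_{n=0}^\infty \frac{(q;q)_{2n}\,q^n}{(aq,q/a;q)_n} =(1-a)\sum_{n=0}^\infty \frac{(q;q)_n\,q^{n^2+n}a^n}{(aq^{n+1};q)_{n+1}} +\frac{a\,(q;q)_\infty}{(aq,q/a;q)_\infty}\sum_{n=0}^\infty (-1)^n a^{2n} q^{3n(n+1)/2}. $$ (Here $0^0=1$ if $q=0$.) -/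

import Mathlib

/-- The `q`-shifted factorial `(a;q)_n = (1-a)(1-aq)⋯(1-aq^{n-1})`, equal to `1` for `n = 0`. -/
noncomputable def qShifted (a q : ℂ) (n : ℕ) : ℂ :=
  ∏ i ∈ Finset.range n, (1 - a * q ^ i)

/-- The infinite `q`-shifted factorial `(a;q)_∞ = ∏_{n ≥ 0} (1 - a q^n)`, for `|q| < 1`. -/
noncomputable def qShiftedInf (a q : ℂ) : ℂ :=
  ∏' n : ℕ, (1 - a * q ^ n)

/-- For `|q| < 1` the product defining `(a;q)_∞` converges, so `qShiftedInf` is not a default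
value. -/
theorem multipliable_qShiftedInf (a : ℂ) {q : ℂ} (hq : ‖q‖ < 1) :
    Multipliable fun n : ℕ => 1 - a * q ^ n := by
  have h : Summable fun n : ℕ => ‖-(a * q ^ n)‖ := by
    simp only [norm_neg, norm_mul, norm_pow]
    exact (summable_geometric_of_lt_one (norm_nonneg q) hq).mul_left _
  simpa [sub_eq_add_neg] using multipliable_one_add_of_summable h

/-! Divide by `1 - a`, work in the annulus `|q| < |a| < 1`, and compare Laurent coefficients in `a`.
Each left-hand term is a rational function of `a` with simple poles, and its partial fractions
(`central_partial_fractions`) have central Gaussian binomials as coefficients. Summation over `n`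
replaces these by `C_k = ∑ q^n [2n, n+k]` (`qCentral`). Geometric expansion then gives the
coefficient of `a^N`: for `N ≥ 0` it is `∑_k (-1)^k q^{k(k+1)/2} C_k q^{kN}`, and for `N < 0` it is
`partialCoeff q N`.

In the theta term, `n → ∞` in the same partial fractions expands `(q;q)_∞² / (a, q/a; q)_∞`
(`reciprocal_theta`). Multiplying by the partial theta series and using `C_k (q;q)_∞ = q^k ∑_n
(-1)^n q^{3n(n+1)/2 + 2nk}` (`qCentral_mul`) yields `partialCoeff q N` for every integer `N`. So
negative powers cancel.

For `N ≥ 0` the difference is, by the finite triple product at `z = q^N`, the terminating sum `∑_n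
q^n (q^{-N}, q^{N+1}; q)_n`. A recurrence in `N` (`sum_qShifted_mul_qShifted`) turns it into the
coefficient of `a^N` in the first right-hand series.

After clearing denominators both sides are holomorphic in `a ≠ 0`, so the identity theorem removes
the annulus restriction. The case `q = 0` is direct. -/

open Filter Topology Finset

/-! ### Shifted factorials: splitting, bounds, holomorphy -/

theorem qShifted_zero (x q : ℂ) : qShifted x q 0 = 1 := by simp [qShifted]

theorem qShifted_succ (x q : ℂ) (n : ℕ) :
    qShifted x q (n + 1) = qShifted x q n * (1 - x * q ^ n) := by
  simp [qShifted, prod_range_succ]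

theorem qShifted_add (x q : ℂ) (m n : ℕ) :
    qShifted x q (m + n) = qShifted x q m * qShifted (x * q ^ m) q n := by
  simp only [qShifted, prod_range_add]
  congr 1
  exact prod_congr rfl fun i _ => by ring

theorem qShifted_succ' (x q : ℂ) (n : ℕ) :
    qShifted x q (n + 1) = (1 - x) * qShifted (x * q) q n := by
  rw [add_comm, qShifted_add]
  simp [qShifted]

theorem qShifted_ne_zero {x q : ℂ} {n : ℕ} (h : ∀ i, x * q ^ i ≠ 1) : qShifted x q n ≠ 0 :=
  prod_ne_zero_iff.2 fun i _ => sub_ne_zero.2 (h i).symm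

theorem tendsto_qShifted (x : ℂ) {q : ℂ} (hq : ‖q‖ < 1) :
    Tendsto (qShifted x q) atTop (𝓝 (qShiftedInf x q)) :=
  (multipliable_qShiftedInf x hq).hasProd.tendsto_prod_nat

theorem qShiftedInf_eq_mul (x : ℂ) {q : ℂ} (hq : ‖q‖ < 1) (n : ℕ) :
    qShiftedInf x q = qShifted x q n * qShiftedInf (x * q ^ n) q := by
  have h1 := (tendsto_qShifted x hq).comp (tendsto_add_atTop_nat n)
  refine tendsto_nhds_unique h1 ?_
  have : (qShifted x q ∘ fun m => m + n) =
      fun m => qShifted x q n * qShifted (x * q ^ n) q m := by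
    ext m
    rw [Function.comp, add_comm, qShifted_add]
  rw [this]
  exact (tendsto_qShifted _ hq).const_mul _

theorem qShiftedInf_ne_zero {x q : ℂ} (hq : ‖q‖ < 1) (h : ∀ i, x * q ^ i ≠ 1) :
    qShiftedInf x q ≠ 0 := by
  have := tprod_one_add_ne_zero_of_summable (R := ℂ) (f := fun n : ℕ => -(x * q ^ n))
    (fun i => by simpa [← sub_eq_add_neg] using sub_ne_zero.2 (h i).symm)
    (by simpa only [norm_neg, norm_mul, norm_pow] using
      (summable_geometric_of_lt_one (norm_nonneg q) hq).mul_left _)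
  simpa only [qShiftedInf, sub_eq_add_neg] using this

theorem norm_qShifted_le {x q : ℂ} (hq : ‖q‖ < 1) {R : ℝ} (hx : ‖x‖ ≤ R) (n : ℕ) :
    ‖qShifted x q n‖ ≤ Real.exp (R / (1 - ‖q‖)) := by
  have hR : 0 ≤ R := (norm_nonneg x).trans hx
  calc ‖qShifted x q n‖ = ∏ i ∈ range n, ‖1 - x * q ^ i‖ := by rw [qShifted, norm_prod]
    _ ≤ ∏ i ∈ range n, (1 + R * ‖q‖ ^ i) := by
        refine prod_le_prod (fun _ _ => norm_nonneg _) fun i _ => ?_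
        refine (norm_sub_le _ _).trans ?_
        rw [norm_one, norm_mul, norm_pow]
        gcongr
    _ ≤ Real.exp (∑ i ∈ range n, R * ‖q‖ ^ i) :=
        Real.prod_one_add_le_exp_sum _ fun i => by positivity
    _ ≤ Real.exp (R / (1 - ‖q‖)) := by
        refine Real.exp_le_exp.2 ?_
        rw [← mul_sum, div_eq_mul_inv, ← tsum_geometric_of_lt_one (norm_nonneg q) hq]
        gcongr
        exact (summable_geometric_of_lt_one (norm_nonneg q) hq).sum_le_tsum _
          fun i _ => by positivity

theorem norm_qShiftedInf_le {x q : ℂ} (hq : ‖q‖ < 1) {R : ℝ} (hx : ‖x‖ ≤ R) :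
    ‖qShiftedInf x q‖ ≤ Real.exp (R / (1 - ‖q‖)) :=
  le_of_tendsto (tendsto_qShifted x hq).norm (Eventually.of_forall (norm_qShifted_le hq hx))

theorem differentiable_qShifted (q : ℂ) (n : ℕ) : Differentiable ℂ fun x => qShifted x q n := by
  unfold qShifted
  fun_prop

theorem differentiable_qShiftedInf {q : ℂ} (hq : ‖q‖ < 1) :
    Differentiable ℂ fun x => qShiftedInf x q := by
  intro x
  have hU : IsOpen (Metric.ball (0 : ℂ) (‖x‖ + 1)) := Metric.isOpen_ball
  have h := Summable.hasProdLocallyUniformlyOn_nat_one_add (f := fun n x => -(x * q ^ n)) hU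
    (u := fun n => (‖x‖ + 1) * ‖q‖ ^ n)
    ((summable_geometric_of_lt_one (norm_nonneg q) hq).mul_left _)
    (Eventually.of_forall fun n y hy => by
      rw [norm_neg, norm_mul, norm_pow]
      gcongr
      simpa using (Metric.mem_ball.1 hy).le)
    (fun n => by fun_prop)
  have h2 := h.tendstoLocallyUniformlyOn_finsetRange.differentiableOn
    (Eventually.of_forall fun n => by fun_prop) hU
  have h3 := h2.differentiableAt (hU.mem_nhds (by simp : x ∈ _))
  simpa only [qShiftedInf, sub_eq_add_neg] using h3

theorem pow_succ_ne_one {q : ℂ} (hq : ‖q‖ < 1) (i : ℕ) : q ^ (i + 1) ≠ 1 := by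
  intro h
  have := congrArg norm h
  rw [norm_pow, norm_one] at this
  exact (pow_lt_one₀ (norm_nonneg q) hq (Nat.succ_ne_zero i)).ne this

theorem mul_pow_ne_one_self {q : ℂ} (hq : ‖q‖ < 1) (i : ℕ) : q * q ^ i ≠ 1 := by
  rw [← pow_succ']
  exact pow_succ_ne_one hq i

theorem qShifted_self_ne_zero {q : ℂ} (hq : ‖q‖ < 1) (n : ℕ) : qShifted q q n ≠ 0 :=
  qShifted_ne_zero (mul_pow_ne_one_self hq)

theorem qShiftedInf_self_ne_zero {q : ℂ} (hq : ‖q‖ < 1) : qShiftedInf q q ≠ 0 :=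
  qShiftedInf_ne_zero hq (mul_pow_ne_one_self hq)

/-- The reciprocals of a convergent nonvanishing `q`-product are bounded. -/
theorem exists_norm_inv_qShifted_le {x q : ℂ} (hq : ‖q‖ < 1) (h : ∀ i, x * q ^ i ≠ 1) :
    ∃ C : ℝ, 0 < C ∧ ∀ n, ‖(qShifted x q n)⁻¹‖ ≤ C := by
  have h1 := ((tendsto_qShifted x hq).inv₀ (qShiftedInf_ne_zero hq h)).norm
  obtain ⟨C, hC⟩ := h1.bddAbove_range
  refine ⟨max C 1, by positivity, fun n => (hC ⟨n, rfl⟩).trans (le_max_left _ _)⟩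

/-! ### Gaussian binomial coefficients -/

/-- The Gaussian binomial coefficient. -/
noncomputable def qBinom (q : ℂ) : ℕ → ℕ → ℂ
  | _, 0 => 1
  | 0, _ + 1 => 0
  | n + 1, k + 1 => qBinom q n k + q ^ (k + 1) * qBinom q n (k + 1)

theorem qBinom_zero_right (q : ℂ) (n : ℕ) : qBinom q n 0 = 1 := by cases n <;> rfl

theorem qBinom_zero_succ (q : ℂ) (k : ℕ) : qBinom q 0 (k + 1) = 0 := rfl

theorem qBinom_succ_succ (q : ℂ) (n k : ℕ) :
    qBinom q (n + 1) (k + 1) = qBinom q n k + q ^ (k + 1) * qBinom q n (k + 1) := rfl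

theorem qBinom_eq_zero (q : ℂ) {n k : ℕ} (h : n < k) : qBinom q n k = 0 := by
  induction n generalizing k with
  | zero => cases k with
    | zero => omega
    | succ k => rfl
  | succ n ih => cases k with
    | zero => omega
    | succ k => rw [qBinom_succ_succ, ih (by omega), ih (by omega)]; simp

theorem qBinom_self (q : ℂ) (n : ℕ) : qBinom q n n = 1 := by
  induction n with
  | zero => rfl
  | succ n ih => rw [qBinom_succ_succ, ih, qBinom_eq_zero q (Nat.lt_succ_self n)]; simp

/-- The second Pascal rule, multiplied by `q^k` so that the exponent `n - k` needs no subtraction.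
-/
theorem qBinom_pascal (q : ℂ) (n k : ℕ) :
    q ^ k * qBinom q (n + 1) (k + 1) = q ^ k * qBinom q n (k + 1) + q ^ n * qBinom q n k := by
  induction n generalizing k with
  | zero => cases k with
    | zero => simp [qBinom_succ_succ, qBinom_zero_right, qBinom_zero_succ]
    | succ k => simp [qBinom_succ_succ, qBinom_zero_succ]
  | succ n ih => cases k with
    | zero =>
      have := ih 0
      simp only [qBinom_succ_succ, qBinom_zero_right] at this ⊢
      linear_combination q * this
    | succ k =>
      have h1 := ih k
      have h2 := ih (k + 1)
      simp only [qBinom_succ_succ] at h1 h2 ⊢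
      linear_combination q * h1 + q ^ (k + 2) * h2

theorem qBinom_add_mul (q : ℂ) (i j : ℕ) :
    qBinom q (i + j) i * (qShifted q q i * qShifted q q j) = qShifted q q (i + j) := by
  induction i generalizing j with
  | zero => simp [qBinom_zero_right, qShifted_zero]
  | succ i ih =>
    induction j with
    | zero => simp [qBinom_self, qShifted_zero]
    | succ j ihj =>
      have h1 := ih (j + 1)
      have e : i + 1 + (j + 1) = (i + 1 + j) + 1 := by ring
      rw [e, qBinom_succ_succ, qShifted_succ q q (i + 1 + j)]
      rw [show i + (j + 1) = i + 1 + j by ring] at h1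
      rw [qShifted_succ q q i, qShifted_succ q q j] at *
      linear_combination (1 - q * q ^ i) * h1 + q ^ (i + 1) * (1 - q * q ^ j) * ihj

theorem qBinom_add {q : ℂ} (hq : ‖q‖ < 1) (i j : ℕ) :
    qBinom q (i + j) i = qShifted q q (i + j) / (qShifted q q i * qShifted q q j) :=
  eq_div_of_mul_eq (mul_ne_zero (qShifted_self_ne_zero hq i) (qShifted_self_ne_zero hq j))
    (qBinom_add_mul q i j)

theorem qBinom_add_symm {q : ℂ} (hq : ‖q‖ < 1) (i j : ℕ) :
    qBinom q (i + j) j = qBinom q (i + j) i := by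
  rw [qBinom_add hq, add_comm, qBinom_add hq, add_comm, mul_comm]

/-- This uniform bound supplies the domination in the later interchanges of sums and limits. -/
theorem exists_norm_qBinom_le {q : ℂ} (hq : ‖q‖ < 1) :
    ∃ C : ℝ, 0 < C ∧ ∀ n k, ‖qBinom q n k‖ ≤ C := by
  obtain ⟨D, hD, h⟩ := exists_norm_inv_qShifted_le hq (mul_pow_ne_one_self hq)
  refine ⟨Real.exp (‖q‖ / (1 - ‖q‖)) * (D * D), by positivity, fun n k => ?_⟩
  rcases le_or_gt k n with hk | hk
  · obtain ⟨j, rfl⟩ := Nat.exists_eq_add_of_le hk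
    rw [qBinom_add hq, div_eq_mul_inv, mul_inv, norm_mul, norm_mul]
    gcongr
    · exact norm_qShifted_le hq le_rfl _
    · exact h _
    · exact h _
  · rw [qBinom_eq_zero q hk, norm_zero]
    positivity

/-! ### The theta weight -/

/-- The signed theta weight `(-1)^k q^{k(k+1)/2}`. -/
noncomputable def qSign (q : ℂ) (k : ℕ) : ℂ := ∏ i ∈ range k, -(q ^ (i + 1))

theorem qSign_zero (q : ℂ) : qSign q 0 = 1 := by simp [qSign]

theorem qSign_succ (q : ℂ) (k : ℕ) : qSign q (k + 1) = -(q ^ (k + 1)) * qSign q k := by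
  rw [qSign, prod_range_succ, mul_comm, qSign]

theorem qSign_add (q : ℂ) (m n : ℕ) : qSign q (m + n) = qSign q m * qSign q n * q ^ (m * n) := by
  induction n with
  | zero => simp [qSign_zero]
  | succ n ih =>
    rw [← add_assoc, qSign_succ, ih, qSign_succ]
    ring

theorem qSign_ne_zero {q : ℂ} (h0 : q ≠ 0) (k : ℕ) : qSign q k ≠ 0 :=
  prod_ne_zero_iff.2 fun _ _ => neg_ne_zero.2 (pow_ne_zero _ h0)

theorem qSign_cube (q : ℂ) (n : ℕ) :
    qSign q n ^ 3 = (-1) ^ n * q ^ (3 * n * (n + 1) / 2) := by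
  induction n with
  | zero => simp [qSign_zero]
  | succ n ih =>
    have e : 3 * (n + 1) * (n + 1 + 1) / 2 = 3 * n * (n + 1) / 2 + 3 * (n + 1) := by
      rw [← Nat.add_mul_div_right _ _ (by norm_num : 0 < 2)]
      congr 1
      ring
    rw [qSign_succ, mul_pow, ih, e]
    ring

/-- Ratio test: consecutive terms have ratio of size `‖q‖^(k+1) |x|`, which tends to `0` for every
`x`. -/
theorem summable_norm_qSign_mul {q : ℂ} (hq : ‖q‖ < 1) (x : ℝ) :
    Summable fun k => ‖qSign q k‖ * x ^ k := by
  refine summable_of_ratio_norm_eventually_le (r := 1 / 2) (by norm_num) ?_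
  have h : Tendsto (fun k => ‖q‖ ^ (k + 1) * |x|) atTop (𝓝 (0 * |x|)) :=
    ((tendsto_pow_atTop_nhds_zero_of_lt_one (norm_nonneg q) hq).comp
      (tendsto_add_atTop_nat 1)).mul_const _
  rw [zero_mul] at h
  filter_upwards [h.eventually (ge_mem_nhds (by norm_num : (0 : ℝ) < 1 / 2))] with k hk
  rw [qSign_succ]
  refine (le_of_eq_of_le ?_
    (mul_le_mul_of_nonneg_right hk (by positivity : 0 ≤ ‖qSign q k‖ * |x| ^ k))).trans_eq ?_
  · simp only [norm_mul, norm_neg, norm_pow, Real.norm_eq_abs, abs_norm]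
    ring
  · simp only [norm_mul, norm_pow, Real.norm_eq_abs, abs_norm]

theorem norm_qSign_le_one {q : ℂ} (hq : ‖q‖ < 1) (k : ℕ) : ‖qSign q k‖ ≤ 1 := by
  rw [qSign, norm_prod]
  refine prod_le_one (fun _ _ => norm_nonneg _) fun i _ => ?_
  rw [norm_neg, norm_pow]
  exact pow_le_one₀ (norm_nonneg q) hq.le

/-! ### Finite identities -/

/-- The finite `q`-binomial theorem, with `(-1)^j q^{j(j-1)/2}` written as `qSign q j / q ^ j`. -/
theorem qShifted_mul_eq_sum (x q : ℂ) (n : ℕ) :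
    qShifted (x * q) q n = ∑ j ∈ range (n + 1), qSign q j * x ^ j * qBinom q n j := by
  induction n generalizing x with
  | zero => simp [qShifted_zero, qSign_zero, qBinom_zero_right]
  | succ n ih =>
    rw [qShifted_succ', ih, sum_range_succ' _ (n + 1), qSign_zero, qBinom_zero_right, sub_mul,
      one_mul]
    simp only [qBinom_succ_succ, mul_add, sum_add_distrib]
    have h1 : ∑ j ∈ range (n + 1), qSign q (j + 1) * x ^ (j + 1) * qBinom q n j =
        -(x * q * ∑ j ∈ range (n + 1), qSign q j * (x * q) ^ j * qBinom q n j) := by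
      rw [mul_sum, ← sum_neg_distrib]
      refine sum_congr rfl fun j _ => ?_
      rw [qSign_succ]
      ring
    have h2 : ∑ j ∈ range (n + 1), qSign q j * (x * q) ^ j * qBinom q n j =
        ∑ j ∈ range (n + 1), qSign q (j + 1) * x ^ (j + 1) * (q ^ (j + 1) * qBinom q n (j + 1))
          + 1 := by
      rw [sum_range_succ', sum_range_succ _ n, qBinom_eq_zero q (Nat.lt_succ_self n)]
      simp only [qSign_zero, qBinom_zero_right, mul_pow]
      simp only [pow_zero, mul_one, mul_zero, add_zero]
      congr 1
      refine sum_congr rfl fun j _ => ?_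
      ring
    rw [h1]
    nth_rewrite 1 [h2]
    ring

theorem qSign_sq (q : ℂ) (k : ℕ) : qSign q k ^ 2 = q ^ (k * (k + 1)) := by
  induction k with
  | zero => simp [qSign_zero]
  | succ k ih =>
    rw [qSign_succ, mul_pow, ih]
    ring

/-- Partial fractions of `x ^ m / (x;q)_{M+1}` for `m ≤ M`. -/
theorem qShifted_partial_fractions {q : ℂ} (h0 : q ≠ 0) (M m : ℕ) (hm : m ≤ M) (x : ℂ)
    (hx : ∀ j, x * q ^ j ≠ 1) :
    qShifted q q M * x ^ m / qShifted x q (M + 1) =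
      ∑ j ∈ range (M + 1), qSign q j / (q ^ j) ^ m * qBinom q M j / (1 - x * q ^ j) := by
  induction M generalizing m x with
  | zero =>
    obtain rfl : m = 0 := by omega
    simp [qShifted_zero, qShifted_succ, qSign_zero, qBinom_zero_right]
  | succ M ih =>
    have hx' : ∀ j, x * q * q ^ j ≠ 1 := fun j => by
      rw [mul_assoc, ← pow_succ']
      exact hx _
    have hD : qShifted (x * q) q M ≠ 0 := qShifted_ne_zero hx'
    have h1 : 1 - x ≠ 0 := sub_ne_zero.2 (by simpa using (hx 0).symm)
    have h2 : 1 - x * q ^ (M + 1) ≠ 0 := sub_ne_zero.2 (hx _).symm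
    have hlast : ∀ m : ℕ, ∑ j ∈ range (M + 1),
        qSign q j / (q ^ j) ^ m * qBinom q M j / (1 - x * q ^ j) =
        ∑ j ∈ range (M + 1), qSign q (j + 1) / (q ^ (j + 1)) ^ m * qBinom q M (j + 1) /
          (1 - x * q ^ (j + 1)) + 1 / (1 - x) := fun m => by
      rw [sum_range_succ', sum_range_succ _ M, qBinom_eq_zero q (Nat.lt_succ_self M)]
      simp [qSign_zero, qBinom_zero_right]
    rw [sum_range_succ' _ (M + 1)]
    cases m with
    | zero =>
      -- From `1 - q^{M+1} = (1 - x q^{M+1}) - q^{M+1} (1 - x)`; the exponent stays `0`, and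
      -- residues match by the second Pascal rule.
      have key : qShifted q q (M + 1) * x ^ 0 / qShifted x q (M + 1 + 1) =
          qShifted q q M * x ^ 0 / qShifted x q (M + 1) -
          q ^ (M + 1) * (qShifted q q M * (x * q) ^ 0 / qShifted (x * q) q (M + 1)) := by
        rw [qShifted_succ' x q (M + 1), qShifted_succ' x, qShifted_succ (x * q), qShifted_succ q q,
          show x * q * q ^ M = x * q ^ (M + 1) by ring]
        field_simp
        ring
      rw [key, ih 0 (Nat.zero_le _) x hx, ih 0 (Nat.zero_le _) _ hx', hlast, mul_sum,
        add_sub_right_comm, ← sum_sub_distrib]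
      congr 1
      · refine sum_congr rfl fun j _ => ?_
        have hj := qBinom_pascal q M j
        have hne : 1 - x * q ^ (j + 1) ≠ 0 := sub_ne_zero.2 (hx _).symm
        rw [show x * q * q ^ j = x * q ^ (j + 1) by ring, mul_div_assoc', ← sub_div]
        congr 1
        rw [qSign_succ]
        simp only [pow_zero, div_one]
        linear_combination q * qSign q j * hj
      · simp [qSign_zero, qBinom_zero_right]
    | succ m =>
      -- From `x (1 - q^{M+1}) = (1 - x q^{M+1}) - (1 - x)`; one factor `x` is spent, so the
      -- exponent drops along with `M`, and residues match by the defining Pascal rule.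
      have key : qShifted q q (M + 1) * x ^ (m + 1) / qShifted x q (M + 1 + 1) =
          qShifted q q M * x ^ m / qShifted x q (M + 1) -
          1 / q ^ m * (qShifted q q M * (x * q) ^ m / qShifted (x * q) q (M + 1)) := by
        rw [qShifted_succ' x q (M + 1), qShifted_succ' x, qShifted_succ (x * q), qShifted_succ q q,
          show x * q * q ^ M = x * q ^ (M + 1) by ring]
        field_simp
        ring
      rw [key, ih m (by omega) x hx, ih m (by omega) _ hx', hlast, mul_sum,
        add_sub_right_comm, ← sum_sub_distrib]
      congr 1
      · refine sum_congr rfl fun j _ => ?_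
        have hne : 1 - x * q ^ (j + 1) ≠ 0 := sub_ne_zero.2 (hx _).symm
        rw [show x * q * q ^ j = x * q ^ (j + 1) by ring, mul_div_assoc', ← sub_div]
        congr 1
        rw [qSign_succ, qBinom_succ_succ]
        field_simp
        ring
      · simp [qSign_zero, qBinom_zero_right]

/-- Centres the sum at index `n`: the second sum runs through the offsets `-(j+1)`. -/
theorem sum_range_two_mul_succ (f : ℕ → ℂ) (n : ℕ) :
    ∑ i ∈ range (2 * n + 1), f i =
      ∑ k ∈ range (n + 1), f (n + k) + ∑ j ∈ range n, f (n - 1 - j) := by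
  rw [sum_range_reflect, show 2 * n + 1 = n + (n + 1) by ring, sum_range_add, add_comm]

theorem qSign_add_div {q : ℂ} (h0 : q ≠ 0) (n k : ℕ) :
    qSign q (n + k) / q ^ (n * (n + k)) = qSign q n / q ^ (n * n) * qSign q k := by
  rw [qSign_add, mul_add, pow_add]
  field_simp

/-- Triangular numbers are symmetric under `k ↦ -1 - k`, so offset `-(j+1)` carries the weight of
offset `j` with opposite sign. -/
theorem qSign_sub_div {q : ℂ} (h0 : q ≠ 0) {n j : ℕ} (h : j < n) :
    qSign q (n - 1 - j) / q ^ (n * (n - 1 - j)) = -(qSign q n / q ^ (n * n) * qSign q j) := by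
  obtain ⟨r, rfl⟩ := Nat.exists_eq_add_of_le' (Nat.succ_le_of_lt h)
  rw [show r + j.succ - 1 - j = r by omega, Nat.succ_eq_add_one, qSign_add, qSign_succ,
    div_mul_eq_mul_div, ← neg_div, div_eq_div_iff (by positivity) (by positivity)]
  have := qSign_sq q j
  rw [show (r + (j + 1)) * (r + (j + 1)) =
    (r + (j + 1)) * r + r * (j + 1) + (j + 1) + j * (j + 1) by ring, pow_add _ _ (j * (j + 1)),
    ← this]
  ring

/-- Factor by factor, `(1 - y q^{-i}) (-q^i) = y (1 - q^i / y)`. -/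
theorem qShifted_div_pow {q y : ℂ} (h0 : q ≠ 0) (hy : y ≠ 0) (n : ℕ) :
    qShifted (y / q ^ n) q n * qSign q n = y ^ n * qShifted (q / y) q n := by
  induction n with
  | zero => simp [qShifted_zero, qSign_zero]
  | succ n ih =>
    rw [qShifted_succ', qShifted_succ, qSign_succ,
      show y / q ^ (n + 1) * q = y / q ^ n by rw [pow_succ]; field_simp]
    have : (1 - y / q ^ (n + 1)) * -q ^ (n + 1) = y * (1 - q / y * q ^ n) := by
      field_simp
      ring
    linear_combination ((1 - y / q ^ (n + 1)) * -q ^ (n + 1)) * ih + 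
      y ^ n * qShifted (q / y) q n * this

theorem qBinom_sub {q : ℂ} (hq : ‖q‖ < 1) {n j : ℕ} (h : j < n) :
    qBinom q (2 * n) (n - 1 - j) = qBinom q (2 * n) (n + (j + 1)) := by
  have := qBinom_add_symm hq (n - 1 - j) (n + (j + 1))
  rw [show n - 1 - j + (n + (j + 1)) = 2 * n by omega] at this
  exact this.symm

/-- The finite form of the Jacobi triple product. -/
theorem finite_triple_product {q z : ℂ} (h0 : q ≠ 0) (hz : z ≠ 0) (hq : ‖q‖ < 1) (n : ℕ) :
    ∑ k ∈ range (n + 1), qSign q k * qBinom q (2 * n) (n + k) * z ^ k -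
      ∑ j ∈ range n, qSign q j * qBinom q (2 * n) (n + (j + 1)) * (z ^ (j + 1))⁻¹ =
    qShifted z⁻¹ q n * qShifted (z * q) q n := by
  have h := qShifted_mul_eq_sum (z / q ^ n) q (2 * n)
  have hw := qSign_ne_zero h0 n
  rw [sum_range_two_mul_succ] at h
  have hL : qShifted (z / q ^ n * q) q (2 * n) * qSign q n =
      z ^ n * q ^ n * (qShifted z⁻¹ q n * qShifted (z * q) q n) := by
    have := qShifted_div_pow h0 (mul_ne_zero hz h0) n
    rw [two_mul, qShifted_add, show z / q ^ n * q * q ^ n = z * q by field_simp,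
      mul_right_comm, show z / q ^ n * q = z * q / q ^ n by ring, this,
      show q / (z * q) = z⁻¹ by field_simp]
    ring
  have h1 : ∑ k ∈ range (n + 1), qSign q (n + k) * (z / q ^ n) ^ (n + k) *
        qBinom q (2 * n) (n + k) =
      z ^ n * (qSign q n / q ^ (n * n)) *
        ∑ k ∈ range (n + 1), qSign q k * qBinom q (2 * n) (n + k) * z ^ k := by
    rw [mul_sum]
    refine sum_congr rfl fun k _ => ?_
    have := qSign_add_div h0 n k
    rw [div_pow, ← pow_mul]
    linear_combination (z ^ (n + k) * qBinom q (2 * n) (n + k)) * this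
  have h2 : ∑ j ∈ range n, qSign q (n - 1 - j) * (z / q ^ n) ^ (n - 1 - j) *
        qBinom q (2 * n) (n - 1 - j) =
      -(z ^ n * (qSign q n / q ^ (n * n)) *
        ∑ j ∈ range n, qSign q j * qBinom q (2 * n) (n + (j + 1)) * (z ^ (j + 1))⁻¹) := by
    rw [mul_sum, ← sum_neg_distrib]
    refine sum_congr rfl fun j hj => ?_
    have hj := mem_range.1 hj
    have := qSign_sub_div h0 hj
    have hb := qBinom_sub hq hj
    have hz' : z ^ n * (z ^ (j + 1))⁻¹ = z ^ (n - 1 - j) := by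
      rw [mul_inv_eq_iff_eq_mul₀ (pow_ne_zero _ hz), ← pow_add]
      congr 1
      omega
    rw [div_pow, ← pow_mul, hb, ← hz']
    linear_combination (z ^ n * (z ^ (j + 1))⁻¹ * qBinom q (2 * n) (n + (j + 1))) * this
  rw [h1, h2] at h
  have hq2 : qSign q n ^ 2 = q ^ (n * n) * q ^ n := by rw [qSign_sq]; ring
  have hc : qSign q n / q ^ (n * n) * qSign q n = q ^ n := by
    rw [div_mul_eq_mul_div, ← sq, hq2]
    field_simp
  have h3 : z ^ n * q ^ n ≠ 0 := by positivity
  refine mul_left_cancel₀ h3 ?_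
  rw [← hL, h, ← hc]
  ring

/-- This is `qShifted_partial_fractions` with `M = 2n`, `m = n` at `x = a / q^n`; the power `x^n`
makes the weights symmetric about the central pole. Fractions with poles at `q^{j+1}` are written in
`q^{j+1}/a`, ready for expansion in `|a| > |q|`. -/
theorem central_partial_fractions {q a : ℂ} (h0 : q ≠ 0) (ha : a ≠ 0) (hq : ‖q‖ < 1)
    (h1 : ∀ j, a * q ^ j ≠ 1) (h2 : ∀ j, a ≠ q ^ (j + 1)) (n : ℕ) :
    qShifted q q (2 * n) / (qShifted a q (n + 1) * qShifted (q / a) q n) =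
    ∑ k ∈ range (n + 1), qSign q k * qBinom q (2 * n) (n + k) / (1 - a * q ^ k) +
      ∑ j ∈ range n, qSign q j * qBinom q (2 * n) (n + (j + 1)) *
        (q ^ (j + 1) / a / (1 - q ^ (j + 1) / a)) := by
  have hx : ∀ j, a / q ^ n * q ^ j ≠ 1 := fun j h => by
    rcases le_or_gt n j with hj | hj
    · obtain ⟨k, rfl⟩ := Nat.exists_eq_add_of_le hj
      refine h1 k ?_
      rw [← h, pow_add]
      field_simp
    · obtain ⟨k, rfl⟩ := Nat.exists_eq_add_of_lt hj
      refine h2 k ?_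
      rw [pow_add, pow_add] at h
      field_simp at h
      rw [h, pow_succ]
  have hw := qSign_ne_zero h0 n
  have hA : qShifted a q (n + 1) ≠ 0 := qShifted_ne_zero h1
  have hB : qShifted (q / a) q n ≠ 0 := qShifted_ne_zero fun i h => h2 i <| by
    field_simp at h
    rw [← h, pow_succ']
  have h := qShifted_partial_fractions h0 (2 * n) n (by omega) (a / q ^ n) hx
  have hL : qShifted q q (2 * n) * (a / q ^ n) ^ n / qShifted (a / q ^ n) q (2 * n + 1) =
      qSign q n / q ^ (n * n) *
        (qShifted q q (2 * n) / (qShifted a q (n + 1) * qShifted (q / a) q n)) := by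
    have hR := qShifted_div_pow h0 ha n
    have hC : qShifted (a / q ^ n) q n ≠ 0 := qShifted_ne_zero hx
    rw [show 2 * n + 1 = n + (n + 1) by ring, qShifted_add,
      show a / q ^ n * q ^ n = a by field_simp, div_pow, ← pow_mul]
    rw [← eq_div_iff hw] at hR
    rw [hR]
    field_simp
  rw [hL, sum_range_two_mul_succ] at h
  have hk : qSign q n / q ^ (n * n) ≠ 0 := by positivity
  refine mul_left_cancel₀ hk ?_
  rw [h, mul_add, mul_sum, mul_sum]
  congr 1
  · refine sum_congr rfl fun k _ => ?_
    have := qSign_add_div h0 n k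
    rw [← pow_mul, mul_comm (n + k) n, this, show a / q ^ n * q ^ (n + k) = a * q ^ k by
      rw [pow_add]; field_simp]
    ring
  · refine sum_congr rfl fun j hj => ?_
    have hj := mem_range.1 hj
    have := qSign_sub_div h0 hj
    rw [← pow_mul, mul_comm (n - 1 - j) n, this, qBinom_sub hq hj,
      show a / q ^ n * q ^ (n - 1 - j) = a / q ^ (j + 1) by
        rw [div_mul_eq_mul_div, div_eq_div_iff (by positivity) (by positivity), mul_assoc,
          ← pow_add]
        congr 2
        omega]
    have e1 : a - q ^ (j + 1) ≠ 0 := sub_ne_zero.2 (h2 j)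
    have e2 : q ^ (j + 1) - a ≠ 0 := sub_ne_zero.2 (h2 j).symm
    have e3 : 1 / (1 - a / q ^ (j + 1)) = -(q ^ (j + 1) / a / (1 - q ^ (j + 1) / a)) := by
      rw [one_sub_div (by positivity), one_sub_div ha]
      field_simp
      ring
    rw [div_eq_mul_one_div, e3]
    ring

/-- Both sides start at `1` and satisfy `S_{N+1} = q^{N+1} + y (1 - q^{N+1}) S_N`. On the right this
is a peeling of the first term; on the left it comes from telescoping. -/
theorem sum_qShifted_mul_qShifted {q : ℂ} (h0 : q ≠ 0) (hq : ‖q‖ < 1) (y : ℂ) (N : ℕ) :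
    ∑ n ∈ range (N + 1), q ^ n * qShifted (q ^ N)⁻¹ q n * qShifted y q n =
      ∑ n ∈ range (N + 1), y ^ n * q ^ (N - n) * qShifted q q N / qShifted q q (N - n) := by
  induction N with
  | zero => simp [qShifted_zero]
  | succ N ih =>
    have hv : qShifted (q ^ N)⁻¹ q (N + 1) = 0 := by
      rw [qShifted_succ, inv_mul_cancel₀ (pow_ne_zero _ h0)]
      simp
    have hv' : qShifted (q ^ (N + 1))⁻¹ q (N + 2) = 0 := by
      rw [qShifted_succ, inv_mul_cancel₀ (pow_ne_zero _ h0)]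
      simp
    have hf : ∑ n ∈ range (N + 2), q ^ n * qShifted (q ^ (N + 1))⁻¹ q n * qShifted y q n =
        q ^ (N + 1) + y * (1 - q ^ (N + 1)) *
          ∑ n ∈ range (N + 1), q ^ n * qShifted (q ^ N)⁻¹ q n * qShifted y q n := by
      have h1 : ∑ n ∈ range (N + 1), q ^ n * qShifted (q ^ N)⁻¹ q n * qShifted y q n =
          ∑ n ∈ range (N + 2), q ^ n * qShifted (q ^ N)⁻¹ q n * qShifted y q n := by
        rw [sum_range_succ _ (N + 1), hv]
        simp
      rw [h1, ← sub_eq_iff_eq_add, mul_sum, ← sum_sub_distrib]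
      -- The telescoping certificate: it vanishes at the upper end because `(q^{-N-1};q)_{N+2} = 0`,
      -- and its lower end gives `q^{N+1}`.
      have h2 := sum_range_sub
        (fun n => -(q ^ (N + 1)) * qShifted (q ^ (N + 1))⁻¹ q n * qShifted y q n) (N + 2)
      simp only [hv', qShifted_zero, mul_zero, zero_mul, mul_one, zero_sub, neg_neg] at h2
      refine (sum_congr rfl fun n _ => ?_).trans h2
      have h3 : qShifted (q ^ (N + 1))⁻¹ q n * (1 - (q ^ (N + 1))⁻¹ * q ^ n) =
          (1 - (q ^ (N + 1))⁻¹) * qShifted (q ^ N)⁻¹ q n := by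
        rw [← qShifted_succ, qShifted_succ']
        congr 2
        rw [pow_succ]
        field_simp
      rw [qShifted_succ, qShifted_succ]
      have h4 : q ^ (N + 1) * (q ^ (N + 1))⁻¹ = 1 := mul_inv_cancel₀ (pow_ne_zero _ h0)
      linear_combination
        (-(y * q ^ n * qShifted y q n * q ^ (N + 1))) * h3 +
        (y * q ^ n * qShifted y q n * qShifted (q ^ N)⁻¹ q n -
          q ^ n * qShifted (q ^ (N + 1))⁻¹ q n * qShifted y q n) * h4
    rw [hf, ih, sum_range_succ' _ (N + 1), mul_sum, add_comm]
    congr 1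
    · refine sum_congr rfl fun n _ => ?_
      rw [Nat.add_sub_add_right, qShifted_succ q q N]
      ring
    · have := qShifted_self_ne_zero hq (N + 1)
      simp only [Nat.sub_zero]
      field_simp

/-! ### Euler's expansion and the central series -/

theorem norm_pow_lt_one {q : ℂ} (hq : ‖q‖ < 1) (j : ℕ) : ‖q ^ (j + 1)‖ < 1 := by
  rw [norm_pow]
  exact pow_lt_one₀ (norm_nonneg q) hq (Nat.succ_ne_zero j)

theorem summable_pow_div_qShifted {q x : ℂ} (hq : ‖q‖ < 1) (hx : ‖x‖ < 1) :
    Summable fun m => x ^ m / qShifted q q m := by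
  obtain ⟨D, hD, h⟩ := exists_norm_inv_qShifted_le hq (mul_pow_ne_one_self hq)
  refine Summable.of_norm_bounded
    ((summable_geometric_of_lt_one (norm_nonneg x) hx).mul_right D) fun m => ?_
  rw [div_eq_mul_inv, norm_mul, norm_pow]
  gcongr
  exact h m

/-- Euler's expansion of `1 / (x;q)_∞` at `x = q^{j+1}`. -/
theorem tsum_pow_div_qShifted {q : ℂ} (hq : ‖q‖ < 1) (j : ℕ) :
    ∑' m, (q ^ (j + 1)) ^ m / qShifted q q m = qShifted q q j / qShiftedInf q q := by
  obtain ⟨D, hD, hb⟩ := exists_norm_inv_qShifted_le hq (mul_pow_ne_one_self hq)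
  have hP := qShiftedInf_self_ne_zero hq
  set E : ℕ → ℂ := fun j => ∑' m, (q ^ (j + 1)) ^ m / qShifted q q m with hE
  have hs : ∀ j : ℕ, Summable fun m => (q ^ (j + 1)) ^ m / qShifted q q m := fun j =>
    summable_pow_div_qShifted hq (norm_pow_lt_one hq j)
  have hrec : ∀ j, E (j + 1) = E j * (1 - q * q ^ j) := fun j => by
    have h1 : E j - E (j + 1) = q ^ (j + 1) * E j := by
      simp only [hE]
      rw [← (hs j).tsum_sub (hs (j + 1)), ((hs j).sub (hs (j + 1))).tsum_eq_zero_add,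
        ← tsum_mul_left]
      simp only [pow_zero, sub_self, zero_add]
      refine tsum_congr fun m => ?_
      have h2 := qShifted_self_ne_zero hq m
      have h3 : 1 - q * q ^ m ≠ 0 := sub_ne_zero.2 (mul_pow_ne_one_self hq m).symm
      rw [qShifted_succ, ← sub_div, div_eq_iff (mul_ne_zero h2 h3)]
      field_simp
      ring
    linear_combination -h1
  have hE0 : ∀ j, E j = E 0 * qShifted q q j := fun j => by
    induction j with
    | zero => simp [qShifted_zero]
    | succ j ih => rw [hrec, ih, qShifted_succ, mul_assoc]
  -- Only the term `m = 0` survives as `j → ∞`; together with `hE0` this determines `E 0`.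
  have hlim : Tendsto E atTop (𝓝 1) := by
    have h1 : ∑' m : ℕ, (if m = 0 then (1 : ℂ) else 0) = 1 := tsum_ite_eq 0 _
    rw [← h1]
    refine tendsto_tsum_of_dominated_convergence (bound := fun m => ‖q‖ ^ m * D)
      ((summable_geometric_of_lt_one (norm_nonneg q) hq).mul_right D) (fun m => ?_)
      (Eventually.of_forall fun j m => ?_)
    · cases m with
      | zero => simp [qShifted_zero]
      | succ m =>
        have h2 : Tendsto (fun j : ℕ => q ^ (j + 1)) atTop (𝓝 0) :=
          (tendsto_pow_atTop_nhds_zero_of_norm_lt_one hq).comp (tendsto_add_atTop_nat 1)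
        simpa using (h2.pow (m + 1)).div_const (qShifted q q (m + 1))
    · rw [div_eq_mul_inv, norm_mul, norm_pow, norm_pow]
      gcongr
      · rw [pow_succ]
        exact mul_le_of_le_one_left (norm_nonneg q) (pow_le_one₀ (norm_nonneg q) hq.le)
      · exact hb m
  have h1 : E 0 * qShiftedInf q q = 1 := by
    refine tendsto_nhds_unique ((tendsto_qShifted q hq).const_mul (E 0)) ?_
    simpa only [← hE0] using hlim
  change E j = _
  rw [hE0, eq_div_iff hP]
  linear_combination qShifted q q j * h1

/-- The series `∑ q^n [2n, n+k]`. -/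
noncomputable def qCentral (q : ℂ) (k : ℕ) : ℂ := ∑' n : ℕ, q ^ n * qBinom q (2 * n) (n + k)

theorem summable_qCentral {q : ℂ} (hq : ‖q‖ < 1) (k : ℕ) :
    Summable fun n : ℕ => q ^ n * qBinom q (2 * n) (n + k) := by
  obtain ⟨C, hC, h⟩ := exists_norm_qBinom_le hq
  refine Summable.of_norm_bounded
    ((summable_geometric_of_lt_one (norm_nonneg q) hq).mul_right C) fun n => ?_
  rw [norm_mul, norm_pow]
  gcongr
  exact h _ _

theorem summable_norm_qSign {q : ℂ} (hq : ‖q‖ < 1) : Summable fun k => ‖qSign q k‖ := by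
  simpa using summable_norm_qSign_mul hq 1

/-- The terms with `n < j` vanish, and `n = m + j` turns the rest into Euler's series at `q^{j+1}`,
whose value cancels the leftover `(q;q)_j`. -/
theorem tsum_pow_mul_qBinom_div {q : ℂ} (hq : ‖q‖ < 1) (j : ℕ) :
    ∑' n, q ^ n * (q ^ n) ^ j * qBinom q n j / qShifted q q n =
      qSign q j ^ 2 / qShiftedInf q q := by
  have hsupp : ∀ n < j, q ^ n * (q ^ n) ^ j * qBinom q n j / qShifted q q n = 0 := fun n hn => by
    rw [qBinom_eq_zero q hn]
    simp
  have hP := qShiftedInf_self_ne_zero hq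
  have hj := qShifted_self_ne_zero hq j
  have hterm : ∀ m : ℕ, q ^ (m + j) * (q ^ (m + j)) ^ j * qBinom q (m + j) j /
      qShifted q q (m + j) =
      q ^ (j * (j + 1)) / qShifted q q j * ((q ^ (j + 1)) ^ m / qShifted q q m) := fun m => by
    have h1 := qShifted_self_ne_zero hq m
    have h2 := qShifted_self_ne_zero hq (m + j)
    rw [qBinom_add_symm hq, qBinom_add hq]
    field_simp
    ring
  have hs : Summable fun m : ℕ => q ^ (m + j) * (q ^ (m + j)) ^ j * qBinom q (m + j) j /
      qShifted q q (m + j) := by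
    simp only [hterm]
    exact (summable_pow_div_qShifted hq (norm_pow_lt_one hq j)).mul_left _
  have hs' : Summable fun n : ℕ => q ^ n * (q ^ n) ^ j * qBinom q n j / qShifted q q n :=
    (summable_nat_add_iff (f := fun n : ℕ =>
      q ^ n * (q ^ n) ^ j * qBinom q n j / qShifted q q n) j).1 hs
  rw [← hs'.sum_add_tsum_nat_add j, sum_eq_zero fun n hn => hsupp n (mem_range.1 hn), zero_add]
  simp only [hterm]
  rw [tsum_mul_left, tsum_pow_div_qShifted hq, qSign_sq]
  field_simp

/-- After `n ↦ n + k` the binomial is `(q^{2k+n+1};q)_n / (q;q)_n`. The finite `q`-binomial theorem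
expands the numerator, and summing over `n` first leaves `tsum_pow_mul_qBinom_div`. -/
theorem qCentral_mul {q : ℂ} (hq : ‖q‖ < 1) (k : ℕ) :
    qCentral q k * qShiftedInf q q = q ^ k * ∑' n, qSign q n ^ 3 * q ^ (2 * n * k) := by
  obtain ⟨C, hC, hb⟩ := exists_norm_qBinom_le hq
  obtain ⟨D, hD, hd⟩ := exists_norm_inv_qShifted_le hq (mul_pow_ne_one_self hq)
  have hP := qShiftedInf_self_ne_zero hq
  have hterm : ∀ n : ℕ, q ^ (n + k) * qBinom q (2 * (n + k)) (n + k + k) =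
      q ^ k * ∑' j, qSign q j * q ^ (2 * k * j) *
        (q ^ n * (q ^ n) ^ j * qBinom q n j / qShifted q q n) := fun n => by
    have h1 : qBinom q (2 * (n + k)) (n + k + k) = qShifted (q ^ (2 * k + n) * q) q n /
        qShifted q q n := by
      have h2 := qBinom_add hq (n + k + k) n
      rw [show n + k + k + n = 2 * (n + k) by ring] at h2
      have h3 : qShifted q q (2 * (n + k)) =
          qShifted q q (n + k + k) * qShifted (q ^ (2 * k + n) * q) q n := by
        rw [show 2 * (n + k) = n + k + k + n by ring, qShifted_add]
        congr 2
        ring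
      have h4 := qShifted_self_ne_zero hq (n + k + k)
      rw [h2, h3]
      field_simp
    rw [h1, qShifted_mul_eq_sum, tsum_eq_sum (s := range (n + 1)) fun j hj => by
      rw [qBinom_eq_zero q (by simpa using hj)]; simp, mul_sum, sum_div, mul_sum]
    refine sum_congr rfl fun j _ => ?_
    ring
  have hs := summable_qCentral hq k
  rw [qCentral, ← hs.sum_add_tsum_nat_add k, sum_eq_zero fun n hn => by
    rw [qBinom_eq_zero q (by have := mem_range.1 hn; omega), mul_zero], zero_add]
  simp only [hterm]
  have hsum : Summable (Function.uncurry fun (n j : ℕ) => qSign q j * q ^ (2 * k * j) *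
      (q ^ n * (q ^ n) ^ j * qBinom q n j / qShifted q q n)) := by
    have h0 := ((summable_geometric_of_lt_one (norm_nonneg q) hq).mul_of_nonneg
      ((summable_norm_qSign hq).mul_right (C * D)) (fun _ => by positivity)
      (fun _ => by positivity))
    refine Summable.of_norm_bounded h0 fun p => ?_
    obtain ⟨n, j⟩ := p
    simp only [Function.uncurry, norm_mul, norm_div, norm_pow]
    have e1 : ‖q‖ ^ (2 * k * j) ≤ 1 := pow_le_one₀ (norm_nonneg q) hq.le
    have e2 : (‖q‖ ^ n) ^ j ≤ 1 := pow_le_one₀ (by positivity)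
      (pow_le_one₀ (norm_nonneg q) hq.le)
    have e3 := hd n
    rw [norm_inv] at e3
    calc _ ≤ ‖qSign q j‖ * 1 * (‖q‖ ^ n * 1 * C * D) := by
          rw [div_eq_mul_inv]
          gcongr
          exact hb _ _
      _ = _ := by ring
  rw [tsum_mul_left, ← hsum.tsum_comm, mul_assoc, ← tsum_mul_right]
  congr 1
  refine tsum_congr fun j => ?_
  rw [tsum_mul_left, tsum_pow_mul_qBinom_div hq]
  field_simp
  ring

/-- Interchange of summation for a series weighted by `qCentral`. -/
theorem hasSum_mul_qCentral {q : ℂ} (hq : ‖q‖ < 1) {u : ℕ → ℂ} (hu : Summable fun k => ‖u k‖)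
    (s : ℕ) :
    HasSum (fun n => q ^ n * ∑' k, u k * qBinom q (2 * n) (n + (k + s)))
      (∑' k, u k * qCentral q (k + s)) := by
  obtain ⟨C, hC, hb⟩ := exists_norm_qBinom_le hq
  have hsum : Summable (Function.uncurry fun (n k : ℕ) =>
      q ^ n * (u k * qBinom q (2 * n) (n + (k + s)))) := by
    have h0 := ((summable_geometric_of_lt_one (norm_nonneg q) hq).mul_of_nonneg
      (hu.mul_right C) (fun _ => by positivity) (fun _ => by positivity))
    refine Summable.of_norm_bounded h0 fun p => ?_
    obtain ⟨n, k⟩ := p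
    simp only [Function.uncurry, norm_mul, norm_pow]
    gcongr
    exact hb _ _
  have h1 := hsum.prod
  have h2 : ∑' k, u k * qCentral q (k + s) =
      ∑' n, ∑' k, q ^ n * (u k * qBinom q (2 * n) (n + (k + s))) := by
    rw [← hsum.tsum_comm]
    refine tsum_congr fun k => ?_
    rw [qCentral, ← tsum_mul_left]
    exact tsum_congr fun n => by ring
  rw [h2]
  simpa only [tsum_mul_left, Function.uncurry] using h1.hasSum

theorem exists_norm_qCentral_le {q : ℂ} (hq : ‖q‖ < 1) : ∃ C, 0 < C ∧ ∀ k, ‖qCentral q k‖ ≤ C := by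
  obtain ⟨C, hC, hb⟩ := exists_norm_qBinom_le hq
  refine ⟨(1 - ‖q‖)⁻¹ * C, mul_pos (inv_pos.2 (by linarith)) hC, fun k => ?_⟩
  rw [← tsum_geometric_of_lt_one (norm_nonneg q) hq, ← tsum_mul_right]
  refine tsum_of_norm_bounded
    ((summable_geometric_of_lt_one (norm_nonneg q) hq).mul_right C).hasSum fun n => ?_
  rw [norm_mul, norm_pow]
  gcongr
  exact hb _ _

/-! ### Power series expansions -/

/-- Geometric expansion of a sum of simple fractions. -/
theorem hasSum_pow_mul_tsum {q a : ℂ} (hq : ‖q‖ < 1) (ha : ‖a‖ < 1) {u : ℕ → ℂ}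
    (hu : Summable fun k => ‖u k‖) :
    HasSum (fun N => a ^ N * ∑' k, u k * (q ^ k) ^ N) (∑' k, u k / (1 - a * q ^ k)) := by
  have hle : ∀ k : ℕ, ‖q ^ k‖ ≤ 1 := fun k => by
    rw [norm_pow]
    exact pow_le_one₀ (norm_nonneg q) hq.le
  have hsum : Summable (Function.uncurry fun (N k : ℕ) => a ^ N * (u k * (q ^ k) ^ N)) := by
    have h0 := ((summable_geometric_of_lt_one (norm_nonneg a) ha).mul_of_nonneg
      hu (fun _ => by positivity) (fun _ => by positivity))
    refine Summable.of_norm_bounded h0 fun p => ?_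
    obtain ⟨N, k⟩ := p
    simp only [Function.uncurry, norm_mul]
    rw [norm_pow a, norm_pow (q ^ k)]
    gcongr
    exact mul_le_of_le_one_right (norm_nonneg _) (pow_le_one₀ (norm_nonneg _) (hle k))
  have h1 := hsum.prod
  have h2 : ∑' k, u k / (1 - a * q ^ k) = ∑' N, ∑' k, a ^ N * (u k * (q ^ k) ^ N) := by
    rw [← hsum.tsum_comm]
    refine tsum_congr fun k => ?_
    have h3 : ‖a * q ^ k‖ < 1 := by
      rw [norm_mul]
      exact (mul_le_of_le_one_right (norm_nonneg _) (hle k)).trans_lt ha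
    rw [div_eq_mul_inv, ← tsum_geometric_of_norm_lt_one h3, ← tsum_mul_left]
    exact tsum_congr fun n => by ring
  rw [h2]
  simpa only [tsum_mul_left, Function.uncurry] using h1.hasSum

/-- Pascal's rule becomes `G_{n+1} = x G_n + x q^{n+1} G_{n+1}` for the generating functions `G_n`.
-/
theorem hasSum_qBinom_mul_pow {q x : ℂ} (hq : ‖q‖ < 1) (hx : ‖x‖ < 1) (n : ℕ) :
    HasSum (fun N => qBinom q N n * x ^ N) (x ^ n / qShifted x q (n + 1)) := by
  obtain ⟨C, hC, hb⟩ := exists_norm_qBinom_le hq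
  have hs : ∀ n, Summable fun N => qBinom q N n * x ^ N := fun n =>
    Summable.of_norm_bounded ((summable_geometric_of_lt_one (norm_nonneg x) hx).mul_left C)
      fun N => by
        rw [norm_mul, norm_pow]
        gcongr
        exact hb _ _
  have hne : ∀ i, x * q ^ i ≠ 1 := fun i h => by
    have := congrArg norm h
    rw [norm_mul, norm_pow, norm_one] at this
    have h2 : ‖q‖ ^ i ≤ 1 := pow_le_one₀ (norm_nonneg q) hq.le
    nlinarith [norm_nonneg x, norm_nonneg q]
  suffices h : ∑' N, qBinom q N n * x ^ N = x ^ n / qShifted x q (n + 1) from h ▸ (hs n).hasSum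
  induction n with
  | zero =>
    simp only [qBinom_zero_right, one_mul, tsum_geometric_of_norm_lt_one hx]
    simp [qShifted]
  | succ n ih =>
    have h1 : ∑' N, qBinom q N (n + 1) * x ^ N = x * (∑' N, qBinom q N n * x ^ N) +
        x * q ^ (n + 1) * ∑' N, qBinom q N (n + 1) * x ^ N := by
      rw [← tsum_mul_left, ← tsum_mul_left,
        ← ((hs n).mul_left x).tsum_add ((hs (n + 1)).mul_left (x * q ^ (n + 1))),
        (hs (n + 1)).tsum_eq_zero_add, qBinom_zero_succ, zero_mul, zero_add]
      refine tsum_congr fun N => ?_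
      rw [qBinom_succ_succ]
      ring
    have h2 : 1 - x * q ^ (n + 1) ≠ 0 := sub_ne_zero.2 (hne _).symm
    have h3 : qShifted x q (n + 1) ≠ 0 := qShifted_ne_zero hne
    rw [ih] at h1
    rw [qShifted_succ x q (n + 1), eq_div_iff (mul_ne_zero h3 h2)]
    field_simp at h1
    linear_combination h1

/-! ### The reciprocal theta function -/

/-- The Laurent coefficients of `(q;q)_∞² / (a, q/a; q)_∞` in `|q| < |a| < 1`. -/
noncomputable def thetaCoeff (q : ℂ) (N : ℤ) : ℂ := ∑' k : ℕ, qSign q k * (q ^ N) ^ k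

theorem summable_qSign_mul_pow {q : ℂ} (hq : ‖q‖ < 1) (z : ℂ) :
    Summable fun k => ‖qSign q k * z ^ k‖ := by
  simpa only [norm_mul, norm_pow] using summable_norm_qSign_mul hq ‖z‖

theorem summable_qSign_mul_inv_pow {q : ℂ} (hq : ‖q‖ < 1) (z : ℂ) :
    Summable fun k => ‖qSign q k * (z ^ (k + 1))⁻¹‖ := by
  refine ((summable_qSign_mul_pow hq z⁻¹).mul_right ‖z⁻¹‖).congr fun k => ?_
  rw [← norm_mul, pow_succ, mul_inv, inv_pow, mul_assoc]

/-- Both sides solve `c(N) = 1 - q^{N+1} c(N+1)` and agree at `N = 0`; as `q ≠ 0`, the recurrence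
runs both ways. Equivalently, the bilateral theta series vanishes at `q^N`. This gives the
coefficients of positive and negative powers one common formula. -/
theorem thetaCoeff_eq {q : ℂ} (h0 : q ≠ 0) (hq : ‖q‖ < 1) (N : ℤ) :
    thetaCoeff q N = ∑' j : ℕ, qSign q j * ((q ^ N) ^ (j + 1))⁻¹ := by
  set d : ℤ → ℂ := fun N => ∑' j : ℕ, qSign q j * ((q ^ N) ^ (j + 1))⁻¹ with hd
  have hc : ∀ N, thetaCoeff q N = 1 - q ^ (N + 1) * thetaCoeff q (N + 1) := fun N => by
    rw [thetaCoeff, (summable_qSign_mul_pow hq (q ^ N)).of_norm.tsum_eq_zero_add, thetaCoeff,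
      ← tsum_mul_left, sub_eq_add_neg, ← tsum_neg]
    simp only [qSign_zero, pow_zero, mul_one]
    congr 1
    refine tsum_congr fun k => ?_
    rw [qSign_succ, zpow_add_one₀ h0]
    ring
  have hd' : ∀ N, d N = 1 - q ^ (N + 1) * d (N + 1) := fun N => by
    have hN : q ^ N ≠ 0 := zpow_ne_zero _ h0
    have h1 : d (N + 1) = (q ^ (N + 1))⁻¹ * (1 - d N) := by
      simp only [hd]
      rw [(summable_qSign_mul_inv_pow hq (q ^ (N + 1))).of_norm.tsum_eq_zero_add, mul_sub, mul_one,
        ← tsum_mul_left, sub_eq_add_neg, ← tsum_neg]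
      simp only [qSign_zero, zero_add, pow_one, one_mul]
      congr 1
      refine tsum_congr fun k => ?_
      rw [qSign_succ, zpow_add_one₀ h0]
      field_simp
      ring
    rw [h1, mul_inv_cancel_left₀ (zpow_ne_zero _ h0)]
    ring
  change thetaCoeff q N = d N
  induction N using Int.induction_on with
  | zero => simp [hd, thetaCoeff]
  | succ n ih =>
    have h1 := hc n
    rw [ih, hd'] at h1
    have h2 : q ^ ((n : ℤ) + 1) ≠ 0 := zpow_ne_zero _ h0
    refine mul_left_cancel₀ h2 ?_
    linear_combination h1
  | pred n ih =>
    rw [hc, hd', show -(n : ℤ) - 1 + 1 = -n by ring, ih]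

theorem one_sub_ne_zero_of_norm_lt {x : ℂ} (hx : ‖x‖ < 1) : 1 - x ≠ 0 := fun h => by
  rw [← sub_eq_zero.1 h, norm_one] at hx
  exact lt_irrefl _ hx

theorem norm_one_sub_inv_le {x : ℂ} {r : ℝ} (hx : ‖x‖ ≤ r) (hr : r < 1) :
    ‖(1 - x)⁻¹‖ ≤ (1 - r)⁻¹ := by
  rw [norm_inv]
  have h1 := norm_sub_norm_le 1 x
  rw [norm_one] at h1
  exact inv_anti₀ (by linarith) (by linarith)

theorem norm_mul_pow_le {q x : ℂ} (hq : ‖q‖ < 1) (k : ℕ) : ‖x * q ^ k‖ ≤ ‖x‖ := by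
  rw [norm_mul, norm_pow]
  exact mul_le_of_le_one_right (norm_nonneg _) (pow_le_one₀ (norm_nonneg q) hq.le)

theorem mul_pow_ne_one {q x : ℂ} (hq : ‖q‖ < 1) (hx : ‖x‖ < 1) (k : ℕ) : x * q ^ k ≠ 1 :=
  fun h => one_sub_ne_zero_of_norm_lt ((norm_mul_pow_le hq k).trans_lt hx) (by rw [h, sub_self])

theorem summable_norm_mul_div {q x : ℂ} (hq : ‖q‖ < 1) (hx : ‖x‖ < 1) {u : ℕ → ℂ}
    (hu : Summable fun k => ‖u k‖) : Summable fun k => ‖u k / (1 - x * q ^ k)‖ := by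
  refine Summable.of_nonneg_of_le (fun _ => norm_nonneg _) (fun k => ?_)
    (hu.mul_right (1 - ‖x‖)⁻¹)
  rw [div_eq_mul_inv, norm_mul]
  gcongr
  exact norm_one_sub_inv_le (norm_mul_pow_le hq k) hx

/-- The numerators of the simple fractions with poles at `q^{j+1}` are summable. -/
theorem summable_norm_qSign_mul_div {q : ℂ} (hq : ‖q‖ < 1) (a : ℂ) :
    Summable fun j => ‖qSign q j * (q ^ (j + 1) / a)‖ := by
  refine Summable.of_nonneg_of_le (fun _ => norm_nonneg _) (fun k => ?_)
    ((summable_norm_qSign hq).mul_right ‖q / a‖)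
  rw [norm_mul, pow_succ', mul_div_right_comm]
  gcongr
  exact norm_mul_pow_le hq k

/-- The central partial fractions as infinite sums with vanishing tails. -/
theorem central_partial_fractions_tsum {q a : ℂ} (h0 : q ≠ 0) (ha : a ≠ 0) (hq : ‖q‖ < 1)
    (h1 : ‖a‖ < 1) (h2 : ‖q / a‖ < 1) (n : ℕ) :
    qShifted q q (2 * n) / (qShifted a q (n + 1) * qShifted (q / a) q n) =
    ∑' k, qSign q k / (1 - a * q ^ k) * qBinom q (2 * n) (n + (k + 0)) +
      ∑' j, qSign q j * (q ^ (j + 1) / a) / (1 - q / a * q ^ j) *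
        qBinom q (2 * n) (n + (j + 1)) := by
  rw [central_partial_fractions h0 ha hq (mul_pow_ne_one hq h1) (fun j h => by
    have := mul_pow_ne_one hq h2 j
    rw [h] at this
    apply this
    rw [pow_succ']
    field_simp) n,
    tsum_eq_sum (s := range (n + 1)) (fun k hk => by
      rw [qBinom_eq_zero q (by have := mem_range.not.1 hk; omega), mul_zero]),
    tsum_eq_sum (s := range n) (fun k hk => by
      rw [qBinom_eq_zero q (by have := mem_range.not.1 hk; omega), mul_zero])]
  congr 1
  · exact sum_congr rfl fun k _ => by rw [add_zero]; ring
  · exact sum_congr rfl fun k _ => by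
      rw [show q / a * q ^ k = q ^ (k + 1) / a by ring]
      ring

theorem tendsto_qBinom_central {q : ℂ} (hq : ‖q‖ < 1) (k : ℕ) :
    Tendsto (fun n => qBinom q (2 * n) (n + k)) atTop (𝓝 (qShiftedInf q q)⁻¹) := by
  have hP := qShiftedInf_self_ne_zero hq
  have ht := tendsto_qShifted q hq
  rw [← tendsto_add_atTop_iff_nat k]
  have h : (fun n => qBinom q (2 * (n + k)) (n + k + k)) = fun n =>
      qShifted q q (2 * (n + k)) / (qShifted q q (n + k + k) * qShifted q q n) := by
    ext n
    rw [show 2 * (n + k) = n + k + k + n by ring, qBinom_add hq]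
  rw [h]
  have h1 : Tendsto (fun n : ℕ => 2 * (n + k)) atTop atTop :=
    tendsto_atTop_mono (fun n => by simp only [id]; omega) tendsto_id
  have h2 : Tendsto (fun n : ℕ => n + k + k) atTop atTop :=
    tendsto_atTop_mono (fun n => by simp only [id]; omega) tendsto_id
  have := (ht.comp h1).div ((ht.comp h2).mul ht) (mul_ne_zero hP hP)
  refine this.trans_eq ?_
  congr 1
  field_simp

theorem tendsto_tsum_mul_qBinom {q : ℂ} (hq : ‖q‖ < 1) {u : ℕ → ℂ}
    (hu : Summable fun k => ‖u k‖) (s : ℕ) :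
    Tendsto (fun n => ∑' k, u k * qBinom q (2 * n) (n + (k + s))) atTop
      (𝓝 ((∑' k, u k) * (qShiftedInf q q)⁻¹)) := by
  obtain ⟨C, hC, hb⟩ := exists_norm_qBinom_le hq
  rw [← tsum_mul_right]
  refine tendsto_tsum_of_dominated_convergence (hu.mul_right C)
    (fun k => (tendsto_qBinom_central hq _).const_mul _) (Eventually.of_forall fun n k => ?_)
  rw [norm_mul]
  gcongr
  exact hb _ _

/-- The partial fraction expansion of the reciprocal theta function. -/
theorem reciprocal_theta {q a : ℂ} (h0 : q ≠ 0) (ha : a ≠ 0) (hq : ‖q‖ < 1)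
    (h1 : ‖a‖ < 1) (h2 : ‖q / a‖ < 1) :
    qShiftedInf q q ^ 2 / (qShiftedInf a q * qShiftedInf (q / a) q) =
    ∑' k, qSign q k / (1 - a * q ^ k) +
      ∑' j, qSign q j * (q ^ (j + 1) / a) / (1 - q / a * q ^ j) := by
  have hP := qShiftedInf_self_ne_zero hq
  have hA := qShiftedInf_ne_zero hq (mul_pow_ne_one hq h1)
  have hB := qShiftedInf_ne_zero hq (mul_pow_ne_one hq h2)
  have hl : Tendsto (fun n => qShifted q q (2 * n) /
      (qShifted a q (n + 1) * qShifted (q / a) q n)) atTop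
      (𝓝 (qShiftedInf q q / (qShiftedInf a q * qShiftedInf (q / a) q))) :=
    ((tendsto_qShifted q hq).comp (tendsto_id.const_mul_atTop' two_pos)).div
      (((tendsto_qShifted a hq).comp (tendsto_add_atTop_nat 1)).mul (tendsto_qShifted _ hq))
      (mul_ne_zero hA hB)
  simp only [central_partial_fractions_tsum h0 ha hq h1 h2] at hl
  have hr := (tendsto_tsum_mul_qBinom hq
    (summable_norm_mul_div hq h1 (summable_norm_qSign hq)) 0).add
    (tendsto_tsum_mul_qBinom hq
    (summable_norm_mul_div hq h2 (summable_norm_qSign_mul_div hq a)) 1)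
  have h := tendsto_nhds_unique hl hr
  rw [← add_mul, eq_mul_inv_iff_mul_eq₀ hP] at h
  rw [← h]
  ring

theorem hasSum_thetaCoeff {q a : ℂ} (h0 : q ≠ 0) (ha : a ≠ 0) (hq : ‖q‖ < 1)
    (h1 : ‖a‖ < 1) (h2 : ‖q / a‖ < 1) :
    HasSum (fun N : ℤ => thetaCoeff q N * a ^ N)
      (qShiftedInf q q ^ 2 / (qShiftedInf a q * qShiftedInf (q / a) q)) := by
  rw [reciprocal_theta h0 ha hq h1 h2]
  refine HasSum.of_nat_of_neg_add_one ?_ ?_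
  · convert hasSum_pow_mul_tsum hq h1 (summable_norm_qSign hq) using 2 with N
    rw [thetaCoeff, mul_comm, zpow_natCast]
    congr 1
    refine tsum_congr fun k => ?_
    rw [zpow_natCast, ← pow_mul, ← pow_mul, mul_comm N]
  · convert hasSum_pow_mul_tsum hq h2 (summable_norm_qSign_mul_div hq a) using 2 with N
    rw [thetaCoeff_eq h0 hq, ← tsum_mul_left, ← tsum_mul_right]
    refine tsum_congr fun k => ?_
    rw [zpow_neg, zpow_neg, inv_pow, inv_inv, ← Nat.cast_succ, zpow_natCast, zpow_natCast, div_pow,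
      Nat.succ_eq_add_one]
    field_simp
    ring

/-! ### The theta quotient times the partial theta function -/

/-- The coefficients of the theta quotient times the partial theta function. -/
noncomputable def partialCoeff (q : ℂ) (N : ℤ) : ℂ :=
  ∑' j : ℕ, qSign q j * ((q ^ N) ^ (j + 1))⁻¹ * qCentral q (j + 1)

/-- With the second form of `thetaCoeff` and the sums exchanged, the sum over `n` is `qCentral_mul`
at `k = j + 1`. The shift `2n + 1` comes from the factor `a^{2n+1}`. -/
theorem tsum_thetaCoeff_shift {q : ℂ} (h0 : q ≠ 0) (hq : ‖q‖ < 1) (N : ℤ) :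
    ∑' n : ℕ, qSign q n ^ 3 * thetaCoeff q (N - (2 * n + 1)) =
      qShiftedInf q q * partialCoeff q N := by
  have hsum : Summable (Function.uncurry fun (j n : ℕ) => qSign q n ^ 3 *
      (qSign q j * ((q ^ (N - (2 * n + 1))) ^ (j + 1))⁻¹)) := by
    have h3 := ((summable_qSign_mul_inv_pow hq (q ^ N)).mul_of_nonneg
      (summable_norm_qSign hq) (fun _ => by positivity) (fun _ => by positivity))
    refine Summable.of_norm_bounded h3 fun p => ?_
    obtain ⟨j, n⟩ := p
    have e : ((q ^ (N - (2 * n + 1))) ^ (j + 1))⁻¹ =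
        ((q ^ N) ^ (j + 1))⁻¹ * (q ^ (2 * n + 1)) ^ (j + 1) := by
      rw [zpow_sub₀ h0, div_pow, inv_div, div_eq_mul_inv, mul_comm]
      norm_cast
    simp only [Function.uncurry]
    rw [e, norm_mul, ← mul_assoc, norm_mul, mul_comm, norm_pow (qSign q n)]
    have e1 := norm_qSign_le_one hq n
    have e2 : ‖(q ^ (2 * n + 1)) ^ (j + 1)‖ ≤ 1 := by
      rw [norm_pow, norm_pow]
      exact pow_le_one₀ (by positivity) (pow_le_one₀ (norm_nonneg q) hq.le)
    have e3 : ‖qSign q n‖ ^ 3 ≤ ‖qSign q n‖ := pow_le_of_le_one (norm_nonneg _) e1 (by norm_num)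
    refine mul_le_mul (mul_le_of_le_one_right (norm_nonneg _) e2) e3 (by positivity)
      (by positivity)
  simp only [thetaCoeff_eq h0 hq, ← tsum_mul_left]
  rw [hsum.tsum_comm, partialCoeff, ← tsum_mul_left]
  refine tsum_congr fun j => ?_
  have h4 := qCentral_mul hq (j + 1)
  rw [mul_comm, mul_assoc, h4, ← tsum_mul_left, ← tsum_mul_left]
  refine tsum_congr fun n => ?_
  rw [zpow_sub₀ h0, div_pow, inv_div]
  norm_cast
  ring

theorem hasSum_partialCoeff {q a : ℂ} (h0 : q ≠ 0) (ha : a ≠ 0) (hq : ‖q‖ < 1)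
    (h1 : ‖a‖ < 1) (h2 : ‖q / a‖ < 1) :
    HasSum (fun N : ℤ => partialCoeff q N * a ^ N)
      (a * qShiftedInf q q / (qShiftedInf a q * qShiftedInf (q / a) q) *
        ∑' n : ℕ, qSign q n ^ 3 * a ^ (2 * n)) := by
  have hP := qShiftedInf_self_ne_zero hq
  have hθ := hasSum_thetaCoeff h0 ha hq h1 h2
  have hT : Summable fun n : ℕ => ‖qSign q n ^ 3 * a ^ (2 * n + 1)‖ := by
    refine Summable.of_nonneg_of_le (fun _ => norm_nonneg _) (fun n => ?_) (summable_norm_qSign hq)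
    rw [norm_mul, norm_pow, norm_pow]
    calc _ ≤ ‖qSign q n‖ * 1 := by
          gcongr
          · exact pow_le_of_le_one (norm_nonneg _) (norm_qSign_le_one hq n) (by norm_num)
          · exact pow_le_one₀ (norm_nonneg a) h1.le
      _ = _ := mul_one _
  -- Sorts the product by total degree: `(N, n)` corresponds to the factors `a^{2n+1}` and
  -- `a^{N-(2n+1)}`.
  let e : ℤ × ℕ ≃ ℕ × ℤ :=
    { toFun := fun p => (p.2, p.1 - (2 * p.2 + 1))
      invFun := fun p => (p.2 + (2 * p.1 + 1), p.1)
      left_inv := fun p => by simp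
      right_inv := fun p => by simp }
  have hprod := summable_mul_of_summable_norm hT hθ.summable.norm
  have hval := hT.of_norm.hasSum.mul hθ hprod
  have hval' := (e.hasSum_iff.2 hval)
  have hfib := hval'.prod_fiberwise (g := fun N : ℤ => qShiftedInf q q * (partialCoeff q N * a ^ N))
    fun N => by
      have hs := (e.summable_iff.2 hprod).prod_factor N
      refine hs.hasSum_iff.2 ?_
      rw [← mul_assoc, ← tsum_thetaCoeff_shift h0 hq, ← tsum_mul_right]
      refine tsum_congr fun n => ?_
      simp only [e, Function.comp, Equiv.coe_fn_mk]
      rw [zpow_sub₀ ha]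
      norm_cast
      field_simp
  have hT' : ∑' n : ℕ, qSign q n ^ 3 * a ^ (2 * n + 1) =
      (∑' n : ℕ, qSign q n ^ 3 * a ^ (2 * n)) * a := by
    rw [← tsum_mul_right]
    exact tsum_congr fun n => by ring
  have hfin := hfib.mul_left (qShiftedInf q q)⁻¹
  simp only [inv_mul_cancel_left₀ hP] at hfin
  refine (congrArg (HasSum _) ?_).mp hfin
  rw [hT']
  field_simp

/-! ### Comparison of coefficients in the annulus -/

theorem summable_norm_mul_qCentral {q : ℂ} (hq : ‖q‖ < 1) {u : ℕ → ℂ}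
    (hu : Summable fun k => ‖u k‖) (s : ℕ) : Summable fun k => ‖u k * qCentral q (k + s)‖ := by
  obtain ⟨C, hC, hb⟩ := exists_norm_qCentral_le hq
  refine Summable.of_nonneg_of_le (fun _ => norm_nonneg _) (fun k => ?_) (hu.mul_right C)
  rw [norm_mul]
  gcongr
  exact hb _

/-- The two series are the halves of the finite triple product at `z = q^N`, weighted by `q^n` and
summed. The factor `(q^{-N};q)_n` kills all `n > N`, and the terminating transformation at `y =
q^{N+1}` applies. -/
theorem tsum_sub_partialCoeff {q : ℂ} (h0 : q ≠ 0) (hq : ‖q‖ < 1) (N : ℕ) :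
    ∑' k, qSign q k * qCentral q k * (q ^ k) ^ N - partialCoeff q N =
      ∑ n ∈ range (N + 1),
        (q ^ (N + 1)) ^ n * q ^ (N - n) * qShifted q q N / qShifted q q (N - n) := by
  have hz : q ^ N ≠ 0 := pow_ne_zero _ h0
  rw [← sum_qShifted_mul_qShifted h0 hq]
  have h1 := hasSum_mul_qCentral hq (summable_qSign_mul_pow hq (q ^ N)) 0
  have h2 := hasSum_mul_qCentral hq (summable_qSign_mul_inv_pow hq (q ^ N)) 1
  have h3 := h1.sub h2
  have h4 : ∀ n, q ^ n * ∑' k, qSign q k * (q ^ N) ^ k * qBinom q (2 * n) (n + (k + 0)) -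
      q ^ n * ∑' k, qSign q k * ((q ^ N) ^ (k + 1))⁻¹ * qBinom q (2 * n) (n + (k + 1)) =
      q ^ n * qShifted (q ^ N)⁻¹ q n * qShifted (q ^ (N + 1)) q n := fun n => by
    rw [pow_succ q N, mul_assoc (q ^ n), ← finite_triple_product h0 hz hq, mul_sub,
      tsum_eq_sum (s := range (n + 1)) (fun k hk => by
        rw [qBinom_eq_zero q (by have := mem_range.not.1 hk; omega), mul_zero]),
      tsum_eq_sum (s := range n) (fun k hk => by
        rw [qBinom_eq_zero q (by have := mem_range.not.1 hk; omega), mul_zero])]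
    congr 2
    · exact sum_congr rfl fun k _ => by rw [add_zero]; ring
    · exact sum_congr rfl fun k _ => by ring
  simp only [h4] at h3
  have h5 := tsum_eq_sum (L := SummationFilter.unconditional ℕ)
    (f := fun n => q ^ n * qShifted (q ^ N)⁻¹ q n * qShifted (q ^ (N + 1)) q n)
    (s := range (N + 1)) ?_
  · rw [← h5, h3.tsum_eq, partialCoeff]
    congr 1
    · refine tsum_congr fun k => ?_
      rw [add_zero]
      ring
  · intro n hn
    obtain ⟨m, rfl⟩ := Nat.exists_eq_add_of_le (not_lt.1 (mem_range.not.1 hn))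
    rw [qShifted_add, qShifted_succ, inv_mul_cancel₀ hz]
    simp

/-- Expand each term by `hasSum_qBinom_mul_pow` at `x = a q^{n+1}`, where `x^n = q^{n²+n} a^n`, and
collect powers of `a`. -/
theorem hasSum_pow_mul_finite {q a : ℂ} (hq : ‖q‖ < 1) (h1 : ‖a‖ < 1) :
    HasSum (fun N => a ^ N * ∑ n ∈ range (N + 1),
        (q ^ (N + 1)) ^ n * q ^ (N - n) * qShifted q q N / qShifted q q (N - n))
      (∑' n : ℕ, qShifted q q n * q ^ (n ^ 2 + n) * a ^ n /
        qShifted (a * q ^ (n + 1)) q (n + 1)) := by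
  obtain ⟨C, hC, hb⟩ := exists_norm_qBinom_le hq
  have hsum : Summable (Function.uncurry fun (N n : ℕ) =>
      qShifted q q n * (qBinom q N n * (a * q ^ (n + 1)) ^ N)) := by
    have h3 := (((summable_geometric_of_lt_one (norm_nonneg a) h1).mul_left
      (Real.exp (‖q‖ / (1 - ‖q‖)) * C)).mul_of_nonneg
      (summable_geometric_of_lt_one (norm_nonneg q) hq) (fun _ => by positivity)
      (fun _ => by positivity))
    refine Summable.of_norm_bounded h3 fun p => ?_
    obtain ⟨N, n⟩ := p
    simp only [Function.uncurry]
    rcases lt_or_ge N n with hn | hn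
    · rw [qBinom_eq_zero q hn, zero_mul, mul_zero, norm_zero]
      positivity
    · have e : n ≤ (n + 1) * N := by nlinarith
      have e1 : (‖q‖ ^ (n + 1)) ^ N ≤ ‖q‖ ^ n := by
        rw [← pow_mul]
        exact pow_le_pow_of_le_one (norm_nonneg q) hq.le e
      rw [norm_mul, norm_mul, mul_pow, norm_mul, norm_pow, norm_pow, norm_pow, ← mul_assoc,
        ← mul_assoc]
      gcongr
      · exact norm_qShifted_le hq le_rfl n
      · exact hb _ _
  have h2 := hsum.prod.hasSum
  simp only [Function.uncurry] at h2
  rw [← hsum.tsum_comm] at h2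
  have h3 : ∀ n, ∑' N, qShifted q q n * (qBinom q N n * (a * q ^ (n + 1)) ^ N) =
      qShifted q q n * q ^ (n ^ 2 + n) * a ^ n / qShifted (a * q ^ (n + 1)) q (n + 1) := fun n => by
    rw [tsum_mul_left,
      (hasSum_qBinom_mul_pow hq ((norm_mul_pow_le hq (n + 1)).trans_lt h1) n).tsum_eq]
    ring
  simp only [h3] at h2
  refine (congrArg (HasSum · _) (funext fun N => ?_)).mp h2
  rw [tsum_eq_sum (s := range (N + 1)) fun n hn => by
    rw [qBinom_eq_zero q (by have := mem_range.not.1 hn; omega)]; simp, mul_sum]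
  refine sum_congr rfl fun n hn => ?_
  obtain ⟨m, rfl⟩ := Nat.exists_eq_add_of_le (Nat.lt_succ_iff.1 (mem_range.1 hn))
  have e1 := qShifted_self_ne_zero hq n
  have e2 := qShifted_self_ne_zero hq m
  rw [qBinom_add hq, Nat.add_sub_cancel_left]
  field_simp
  ring

/-- The identity in the annulus `|q| < |a| < 1`, divided by `1 - a`. -/
theorem identity_on_annulus {q a : ℂ} (h0 : q ≠ 0) (ha : a ≠ 0) (hq : ‖q‖ < 1)
    (h1 : ‖a‖ < 1) (h2 : ‖q / a‖ < 1) :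
    ∑' n, q ^ n * (qShifted q q (2 * n) / (qShifted a q (n + 1) * qShifted (q / a) q n)) =
      ∑' n : ℕ, qShifted q q n * q ^ (n ^ 2 + n) * a ^ n /
        qShifted (a * q ^ (n + 1)) q (n + 1) +
      a * qShiftedInf q q / (qShiftedInf a q * qShiftedInf (q / a) q) *
        ∑' n : ℕ, qSign q n ^ 3 * a ^ (2 * n) := by
  have hL := (hasSum_mul_qCentral hq (summable_norm_mul_div hq h1 (summable_norm_qSign hq)) 0).add
    (hasSum_mul_qCentral hq (summable_norm_mul_div hq h2 (summable_norm_qSign_mul_div hq a)) 1)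
  simp only [← mul_add, ← central_partial_fractions_tsum h0 ha hq h1 h2] at hL
  have hU1 := hasSum_pow_mul_tsum hq h1
    (summable_norm_mul_qCentral hq (summable_norm_qSign hq) 0)
  have hU2 := hasSum_pow_mul_tsum hq h2
    (summable_norm_mul_qCentral hq (summable_norm_qSign_mul_div hq a) 1)
  have hR := hasSum_partialCoeff h0 ha hq h1 h2
  have hG := hasSum_pow_mul_finite hq h1
  have hs1 : Summable fun N : ℕ => partialCoeff q N * a ^ (N : ℤ) :=
    hR.summable.comp_injective Nat.cast_injective
  have hs2 : Summable fun N : ℕ => partialCoeff q (-(N + 1)) * a ^ (-(N + 1) : ℤ) :=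
    hR.summable.comp_injective (i := fun N : ℕ => (-(N + 1) : ℤ)) fun x y h => by
      simpa using h
  have hsplit := tsum_of_nat_of_neg_add_one (f := fun N : ℤ => partialCoeff q N * a ^ N) hs1 hs2
  -- The negative powers of the theta term resum to the fractions in `q/a` on the left, so they
  -- cancel.
  have hneg : ∑' N : ℕ, partialCoeff q (-(N + 1)) * a ^ (-(N + 1) : ℤ) =
      ∑' j, qSign q j * (q ^ (j + 1) / a) * qCentral q (j + 1) / (1 - q / a * q ^ j) := by
    rw [← hU2.tsum_eq]
    refine tsum_congr fun N => ?_
    rw [partialCoeff, ← tsum_mul_left, ← tsum_mul_right]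
    refine tsum_congr fun k => ?_
    rw [zpow_neg, zpow_neg, inv_pow, inv_inv, ← Nat.cast_succ, zpow_natCast, zpow_natCast, div_pow,
      Nat.succ_eq_add_one]
    field_simp
    ring
  have hpos := hU1.sub hs1.hasSum
  have hdiff : ∀ N : ℕ, a ^ N * ∑' k, qSign q k * qCentral q (k + 0) * (q ^ k) ^ N -
      partialCoeff q N * a ^ (N : ℤ) = a ^ N * ∑ n ∈ range (N + 1),
        (q ^ (N + 1)) ^ n * q ^ (N - n) * qShifted q q N / qShifted q q (N - n) := fun N => by
    rw [← tsum_sub_partialCoeff h0 hq, zpow_natCast]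
    simp only [add_zero]
    ring
  simp only [hdiff] at hpos
  have hfin := hpos.unique hG
  rw [hR.tsum_eq, hneg] at hsplit
  rw [hL.tsum_eq, hsplit, ← hfin]
  have c1 : ∑' k, qSign q k / (1 - a * q ^ k) * qCentral q (k + 0) =
      ∑' k, qSign q k * qCentral q (k + 0) / (1 - a * q ^ k) :=
    tsum_congr fun k => by ring
  have c2 : ∑' j, qSign q j * (q ^ (j + 1) / a) / (1 - q / a * q ^ j) * qCentral q (j + 1) =
      ∑' j, qSign q j * (q ^ (j + 1) / a) * qCentral q (j + 1) / (1 - q / a * q ^ j) :=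
    tsum_congr fun k => by ring
  rw [c1, c2]
  ring

/-! ### Clearing denominators and analytic continuation -/

theorem norm_qSign_pow_mul_le {q : ℂ} (hq : ‖q‖ < 1) {x : ℂ} {R : ℝ} (hx : ‖x‖ ≤ R) (m n : ℕ) :
    ‖qSign q n ^ (m + 1) * x ^ n‖ ≤ ‖qSign q n‖ * R ^ n := by
  rw [norm_mul, norm_pow, norm_pow]
  gcongr
  exact pow_le_of_le_one (norm_nonneg _) (norm_qSign_le_one hq n) (Nat.succ_ne_zero m)

theorem summable_qSign_pow_mul {q : ℂ} (hq : ‖q‖ < 1) (x : ℂ) (m : ℕ) :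
    Summable fun n => qSign q n ^ (m + 1) * x ^ n :=
  Summable.of_norm_bounded (summable_norm_qSign_mul hq ‖x‖) (norm_qSign_pow_mul_le hq le_rfl m)

/-- The left-hand series multiplied by `(aq, q/a; q)_∞`. -/
noncomputable def clearedLeft (q a : ℂ) : ℂ :=
  ∑' n : ℕ, qShifted q q (2 * n) * q ^ n *
    (qShiftedInf (a * q ^ (n + 1)) q * qShiftedInf (q ^ (n + 1) / a) q)

/-- The first right-hand series multiplied by `(aq; q)_∞`. -/
noncomputable def clearedRight (q a : ℂ) : ℂ :=
  ∑' n : ℕ, qShifted q q n * (qSign q n ^ 2 * a ^ n) *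
    (qShifted (a * q) q n * qShiftedInf (a * q ^ (2 * n + 2)) q)

/-- The partial theta function. -/
noncomputable def partialTheta (q a : ℂ) : ℂ := ∑' n : ℕ, qSign q n ^ 3 * (a ^ 2) ^ n

theorem isOpen_annulus (r R : ℝ) : IsOpen {a : ℂ | r < ‖a‖ ∧ ‖a‖ < R} :=
  (isOpen_lt continuous_const continuous_norm).inter (isOpen_lt continuous_norm continuous_const)

/-- On an annulus both `a` and `1/a` are bounded, which is what the Weierstrass test for the cleared
series requires. -/
theorem differentiableOn_compl_zero_of_annulus {f : ℂ → ℂ}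
    (h : ∀ r R : ℝ, 0 < r → r < R → DifferentiableOn ℂ f {a : ℂ | r < ‖a‖ ∧ ‖a‖ < R}) :
    DifferentiableOn ℂ f {0}ᶜ := fun a ha => by
  have ha' : 0 < ‖a‖ := norm_pos_iff.2 ha
  exact ((h (‖a‖ / 2) (‖a‖ + 1) (by linarith) (by linarith)).differentiableAt
    ((isOpen_annulus _ _).mem_nhds ⟨by linarith, by linarith⟩)).differentiableWithinAt

theorem differentiableOn_clearedLeft {q : ℂ} (hq : ‖q‖ < 1) :
    DifferentiableOn ℂ (clearedLeft q) {0}ᶜ := by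
  refine differentiableOn_compl_zero_of_annulus fun r R hr hrR => ?_
  refine Complex.differentiableOn_tsum_of_summable_norm (u := fun n =>
    Real.exp (‖q‖ / (1 - ‖q‖)) * ‖q‖ ^ n *
      (Real.exp (R / (1 - ‖q‖)) * Real.exp (1 / r / (1 - ‖q‖))))
    (((summable_geometric_of_lt_one (norm_nonneg q) hq).mul_left _).mul_right _)
    (fun n => ?_) (isOpen_annulus r R) (fun n a ha => ?_)
  · have hd := differentiable_qShiftedInf hq
    refine DifferentiableOn.const_mul (DifferentiableOn.mul ?_ ?_) _
    · exact (hd.comp (differentiable_id.mul_const (q ^ (n + 1)))).differentiableOn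
    · intro a ha
      have ha0 : a ≠ 0 := norm_pos_iff.1 (hr.trans ha.1)
      exact ((hd _).comp a ((differentiableAt_const _).div differentiableAt_id ha0)
        ).differentiableWithinAt
  · rw [norm_mul, norm_mul, norm_mul, norm_pow]
    gcongr
    · exact norm_qShifted_le hq le_rfl _
    · exact norm_qShiftedInf_le hq ((norm_mul_pow_le hq _).trans ha.2.le)
    · refine norm_qShiftedInf_le hq ?_
      rw [norm_div, norm_pow]
      gcongr
      · exact pow_le_one₀ (norm_nonneg q) hq.le
      · exact ha.1.le

theorem differentiableOn_clearedRight {q : ℂ} (hq : ‖q‖ < 1) :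
    DifferentiableOn ℂ (clearedRight q) {0}ᶜ := by
  refine differentiableOn_compl_zero_of_annulus fun r R hr hrR => ?_
  refine Complex.differentiableOn_tsum_of_summable_norm (u := fun n =>
    Real.exp (‖q‖ / (1 - ‖q‖)) * (‖qSign q n‖ * R ^ n) *
      (Real.exp (R / (1 - ‖q‖)) * Real.exp (R / (1 - ‖q‖))))
    (((summable_norm_qSign_mul hq R).mul_left _).mul_right _)
    (fun n => ?_) (isOpen_annulus r R) (fun n a ha => ?_)
  · have h1 : Differentiable ℂ fun a => qShiftedInf (a * q ^ (2 * n + 2)) q :=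
      (differentiable_qShiftedInf hq).comp (differentiable_id.mul_const (q ^ (2 * n + 2)))
    have h2 : Differentiable ℂ fun a => qShifted (a * q) q n :=
      (differentiable_qShifted q n).comp (differentiable_id.mul_const q)
    exact Differentiable.differentiableOn (by fun_prop)
  · have hR : 0 < R := hr.trans hrR
    rw [norm_mul, norm_mul, norm_mul (qShifted (a * q) q n)]
    gcongr
    · exact norm_qShifted_le hq le_rfl _
    · exact norm_qSign_pow_mul_le hq ha.2.le 1 n
    · refine norm_qShifted_le hq (le_trans ?_ ha.2.le) _
      simpa using norm_mul_pow_le (x := a) hq 1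
    · exact norm_qShiftedInf_le hq ((norm_mul_pow_le hq _).trans ha.2.le)

theorem differentiableOn_partialTheta {q : ℂ} (hq : ‖q‖ < 1) :
    DifferentiableOn ℂ (partialTheta q) {0}ᶜ := by
  refine differentiableOn_compl_zero_of_annulus fun r R hr hrR => ?_
  refine Complex.differentiableOn_tsum_of_summable_norm (u := fun n => ‖qSign q n‖ * (R ^ 2) ^ n)
    (summable_norm_qSign_mul hq _) (fun n => by fun_prop) (isOpen_annulus r R) (fun n a ha => ?_)
  refine norm_qSign_pow_mul_le hq ?_ 2 n
  rw [norm_pow]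
  have := ha.2.le
  gcongr

theorem clearedLeft_eq {q a : ℂ} (hq : ‖q‖ < 1) (h1 : ∀ i, a * q * q ^ i ≠ 1)
    (h2 : ∀ i, q / a * q ^ i ≠ 1) :
    clearedLeft q a = qShiftedInf (a * q) q * qShiftedInf (q / a) q *
      ∑' n : ℕ, qShifted q q (2 * n) * q ^ n / (qShifted (a * q) q n * qShifted (q / a) q n) := by
  rw [clearedLeft, ← tsum_mul_left]
  refine tsum_congr fun n => ?_
  have e1 : qShifted (a * q) q n ≠ 0 := qShifted_ne_zero h1
  have e2 : qShifted (q / a) q n ≠ 0 := qShifted_ne_zero h2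
  rw [qShiftedInf_eq_mul (a * q) hq n, qShiftedInf_eq_mul (q / a) hq n,
    show a * q * q ^ n = a * q ^ (n + 1) by ring, show q / a * q ^ n = q ^ (n + 1) / a by ring]
  field_simp

theorem qShifted_shift_eq {q a : ℂ} (n : ℕ) :
    qShifted (a * q) q (2 * n + 1) =
      qShifted (a * q) q n * qShifted (a * q ^ (n + 1)) q (n + 1) := by
  rw [show 2 * n + 1 = n + (n + 1) by ring, qShifted_add]
  congr 2
  ring

theorem clearedRight_eq {q a : ℂ} (hq : ‖q‖ < 1) (h1 : ∀ i, a * q * q ^ i ≠ 1) :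
    clearedRight q a = qShiftedInf (a * q) q *
      ∑' n : ℕ, qShifted q q n * q ^ (n ^ 2 + n) * a ^ n /
        qShifted (a * q ^ (n + 1)) q (n + 1) := by
  rw [clearedRight, ← tsum_mul_left]
  refine tsum_congr fun n => ?_
  have e1 : qShifted (a * q) q (2 * n + 1) ≠ 0 := qShifted_ne_zero h1
  rw [qShifted_shift_eq] at e1
  have e2 := right_ne_zero_of_mul e1
  rw [qShiftedInf_eq_mul (a * q) hq (2 * n + 1), qShifted_shift_eq, qSign_sq,
    show a * q * q ^ (2 * n + 1) = a * q ^ (2 * n + 2) by ring,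
    show n * (n + 1) = n ^ 2 + n by ring]
  field_simp

theorem cleared_identity_on_annulus {q a : ℂ} (h0 : q ≠ 0) (ha : a ≠ 0) (hq : ‖q‖ < 1)
    (h1 : ‖a‖ < 1) (h2 : ‖q / a‖ < 1) :
    clearedLeft q a = (1 - a) * qShiftedInf (q / a) q * clearedRight q a +
      a * qShiftedInf q q * partialTheta q a := by
  have hA := qShiftedInf_ne_zero hq (mul_pow_ne_one hq h1)
  have hB := qShiftedInf_ne_zero hq (mul_pow_ne_one hq h2)
  have h3 : ∀ i, a * q * q ^ i ≠ 1 := fun i => by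
    rw [mul_assoc, ← pow_succ']
    exact mul_pow_ne_one hq h1 _
  have h4 := one_sub_ne_zero_of_norm_lt h1
  have hA' := qShiftedInf_ne_zero hq h3
  have hAe : qShiftedInf a q = (1 - a) * qShiftedInf (a * q) q := by
    simpa [qShifted] using qShiftedInf_eq_mul a hq 1
  rw [clearedLeft_eq hq h3 (mul_pow_ne_one hq h2), clearedRight_eq hq h3]
  have h := identity_on_annulus h0 ha hq h1 h2
  have hL : ∑' n, q ^ n * (qShifted q q (2 * n) / (qShifted a q (n + 1) * qShifted (q / a) q n)) =
      (1 - a)⁻¹ * ∑' n : ℕ, qShifted q q (2 * n) * q ^ n /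
        (qShifted (a * q) q n * qShifted (q / a) q n) := by
    rw [← tsum_mul_left]
    refine tsum_congr fun n => ?_
    rw [qShifted_succ']
    field_simp
  have hT : ∑' n : ℕ, qSign q n ^ 3 * a ^ (2 * n) = partialTheta q a :=
    tsum_congr fun n => by rw [pow_mul]
  rw [hL, hT, hAe, inv_mul_eq_iff_eq_mul₀ h4] at h
  rw [h]
  field_simp

/-- Identity theorem on the connected set `ℂ \ {0}`: both sides are holomorphic there and agree near
a real point `s` with `‖q‖ < s < 1`. -/
theorem cleared_identity {q a : ℂ} (h0 : q ≠ 0) (ha : a ≠ 0) (hq : ‖q‖ < 1) :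
    clearedLeft q a = (1 - a) * qShiftedInf (q / a) q * clearedRight q a +
      a * qShiftedInf q q * partialTheta q a := by
  have hB : DifferentiableOn ℂ (fun a => qShiftedInf (q / a) q) {0}ᶜ := fun a ha =>
    ((differentiable_qShiftedInf hq _).comp a ((differentiableAt_const q).div differentiableAt_id ha)
      ).differentiableWithinAt
  have hl := differentiableOn_clearedLeft hq
  have hr := differentiableOn_clearedRight hq
  have ht := differentiableOn_partialTheta hq
  have hopen : IsOpen ({0}ᶜ : Set ℂ) := isOpen_compl_singleton
  have hF : DifferentiableOn ℂ (fun a => (1 - a) * qShiftedInf (q / a) q * clearedRight q a +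
      a * qShiftedInf q q * partialTheta q a) {0}ᶜ := by fun_prop
  have hconn : IsPreconnected ({0}ᶜ : Set ℂ) :=
    (isConnected_compl_singleton_of_one_lt_rank (by simp) 0).isPreconnected
  have hq0 : 0 < ‖q‖ := norm_pos_iff.2 h0
  obtain ⟨s, hs1, hs2⟩ := exists_between hq
  have hs0 : ‖(s : ℂ)‖ = s := by
    rw [Complex.norm_real, Real.norm_of_nonneg (hq0.trans hs1).le]
  have hs3 : (s : ℂ) ∈ ({0}ᶜ : Set ℂ) := by
    rw [Set.mem_compl_singleton_iff, ← norm_pos_iff, hs0]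
    exact hq0.trans hs1
  refine (hl.analyticOnNhd hopen).eqOn_of_preconnected_of_eventuallyEq (hF.analyticOnNhd hopen)
    hconn hs3 ?_ ha
  have hmem : {a : ℂ | ‖q‖ < ‖a‖ ∧ ‖a‖ < 1} ∈ 𝓝 (s : ℂ) :=
    (isOpen_annulus ‖q‖ 1).mem_nhds ⟨by rwa [hs0], by rwa [hs0]⟩
  filter_upwards [hmem] with b hb
  have hb0 : 0 < ‖b‖ := hq0.trans hb.1
  exact cleared_identity_on_annulus h0 (norm_pos_iff.1 hb0) hq hb.2
    (by rw [norm_div, div_lt_one hb0]; exact hb.1)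

/-! ### Absolute convergence and the theorem -/

theorem summable_left {q a : ℂ} (hq : ‖q‖ < 1) (h1 : ∀ i, a * q * q ^ i ≠ 1)
    (h2 : ∀ i, q / a * q ^ i ≠ 1) :
    Summable fun n : ℕ =>
      qShifted q q (2 * n) * q ^ n / (qShifted (a * q) q n * qShifted (q / a) q n) := by
  obtain ⟨C, hC, hc⟩ := exists_norm_inv_qShifted_le hq h1
  obtain ⟨D, hD, hd⟩ := exists_norm_inv_qShifted_le hq h2
  refine Summable.of_norm_bounded (((summable_geometric_of_lt_one (norm_nonneg q) hq).mul_left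
    (Real.exp (‖q‖ / (1 - ‖q‖)))).mul_right (C * D)) fun n => ?_
  rw [div_eq_mul_inv, mul_inv, norm_mul, norm_mul, norm_mul, norm_pow]
  gcongr
  · exact norm_qShifted_le hq le_rfl _
  · exact hc n
  · exact hd n

theorem summable_right {q a : ℂ} (hq : ‖q‖ < 1) (h1 : ∀ i, a * q * q ^ i ≠ 1) :
    Summable fun n : ℕ => qShifted q q n * q ^ (n ^ 2 + n) * a ^ n /
        qShifted (a * q ^ (n + 1)) q (n + 1) := by
  obtain ⟨C, hC, hc⟩ := exists_norm_inv_qShifted_le hq h1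
  have h3 := ((summable_norm_qSign_mul hq ‖a‖).mul_left (Real.exp (‖q‖ / (1 - ‖q‖)))).mul_right
    (Real.exp (‖a‖ / (1 - ‖q‖)) * C)
  refine Summable.of_norm_bounded h3 fun n => ?_
  have e1 : qShifted (a * q) q n ≠ 0 := qShifted_ne_zero h1
  have e : qShifted q q n * q ^ (n ^ 2 + n) * a ^ n / qShifted (a * q ^ (n + 1)) q (n + 1) =
      qShifted q q n * (qSign q n ^ 2 * a ^ n) *
        (qShifted (a * q) q n * (qShifted (a * q) q (2 * n + 1))⁻¹) := by
    rw [qShifted_shift_eq, qSign_sq, mul_inv, mul_inv_cancel_left₀ e1,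
      show n * (n + 1) = n ^ 2 + n by ring]
    ring
  rw [e, norm_mul, norm_mul, norm_mul (qShifted (a * q) q n)]
  gcongr
  · exact norm_qShifted_le hq le_rfl _
  · exact norm_qSign_pow_mul_le hq le_rfl 1 n
  · refine norm_qShifted_le hq ?_ _
    simpa using norm_mul_pow_le (x := a) hq 1
  · exact hc _

theorem mainTheorem3 (a q : ℂ) (hq : ‖q‖ < 1) (ha : a ≠ 0)
    (haq : ∀ k : ℕ, 1 ≤ k → a * q ^ k ≠ 1) (hqa : ∀ k : ℕ, 1 ≤ k → a ≠ q ^ k) :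
    Summable (fun n : ℕ =>
      qShifted q q (2 * n) * q ^ n / (qShifted (a * q) q n * qShifted (q / a) q n)) ∧
    Summable (fun n : ℕ =>
      qShifted q q n * q ^ (n ^ 2 + n) * a ^ n / qShifted (a * q ^ (n + 1)) q (n + 1)) ∧
    Summable (fun n : ℕ =>
      (-1 : ℂ) ^ n * a ^ (2 * n) * q ^ ((3 * n * (n + 1)) / 2)) ∧
    ∑' n : ℕ, qShifted q q (2 * n) * q ^ n / (qShifted (a * q) q n * qShifted (q / a) q n) =
      (1 - a) * ∑' n : ℕ,
        qShifted q q n * q ^ (n ^ 2 + n) * a ^ n / qShifted (a * q ^ (n + 1)) q (n + 1) +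
      a * qShiftedInf q q / (qShiftedInf (a * q) q * qShiftedInf (q / a) q) *
        ∑' n : ℕ, (-1 : ℂ) ^ n * a ^ (2 * n) * q ^ ((3 * n * (n + 1)) / 2) := by
  have h1 : ∀ i, a * q * q ^ i ≠ 1 := fun i => by
    rw [mul_assoc, ← pow_succ']
    exact haq _ (Nat.succ_pos i)
  have h2 : ∀ i, q / a * q ^ i ≠ 1 := fun i h => hqa (i + 1) (Nat.succ_pos i) <| by
    rw [div_mul_eq_mul_div, div_eq_one_iff_eq ha] at h
    rw [← h, pow_succ']
  have hT : ∀ n : ℕ, (-1 : ℂ) ^ n * a ^ (2 * n) * q ^ ((3 * n * (n + 1)) / 2) =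
      qSign q n ^ 3 * (a ^ 2) ^ n := fun n => by
    rw [qSign_cube, pow_mul]
    ring
  simp only [hT]
  refine ⟨summable_left hq h1 h2, summable_right hq h1, summable_qSign_pow_mul hq _ 2, ?_⟩
  -- At `q = 0` only the terms `n = 0` survive, and the identity reads `1 = (1 - a) + a`.
  rcases eq_or_ne q 0 with rfl | h0
  · have hs : ∀ n : ℕ, n ≠ 0 → qSign 0 n = 0 := fun n hn => by
      obtain ⟨m, rfl⟩ := Nat.exists_eq_succ_of_ne_zero hn
      simp [qSign_succ]
    rw [tsum_eq_single 0 fun n hn => by simp [hn], tsum_eq_single 0 fun n hn => by simp [hn],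
      tsum_eq_single 0 fun n hn => by simp [hs n hn]]
    simp [qShifted, qShiftedInf, qSign_zero]
  · have hA := qShiftedInf_ne_zero hq h1
    have hB := qShiftedInf_ne_zero hq h2
    have h := cleared_identity h0 ha hq
    rw [clearedLeft_eq hq h1 h2, clearedRight_eq hq h1, partialTheta] at h
    refine mul_left_cancel₀ (mul_ne_zero hA hB) ?_
    rw [h]
    field_simp
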